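/- Setting. Let $Y\to X$ be a smooth fiber bundle, $\mathcal O_\infty Y$ the ring of smooth real functions on the finite order jet manifolds $J^rY$, $d_\Lambda$ the iterated total derivatives, and $\mathcal E$ a differential operator on $Y$ with values in a vector bundle $E\to X$, given locally by functions $\mathcal E^a\in\mathcal O_\infty Y$. Let $N\ge 0$ and let $E_0,\dots,E_N$ be vector bundles over $X$. For $-1\le k\le N$ (with $E_{-1}=E$, $c^{r_{-1}}=c^a$) let $\mathcal P_\infty\{k\}$ be the graded-commutative $\mathcal O_\infty Y$-algebra generated by the jets $c^{r_i}_\Lambda$, $-1\le i\le k$, of local fiber bases $c^{r_i}$ of $E_i^*$, where $c^{r_i}_\Lambda$ has antifield number $i+2$ and Grassmann parity $i+2$ mod $2$; a subscript $d$ denotes the part of antifield number $d$. Let $\delta$ be the right derivation of $\mathcal P_\infty\{N\}$ over $\mathcal O_\infty Y$, commuting with total derivatives, with $\delta c^a=\mathcal E^a$ and $\delta c^{r_i}=0$ for $i\ge 0$. Let $\delta_N$ be an $N$-stage Koszul–Tate differential: a nilpotent right derivation of $\mathcal P_\infty\{N\}$ over $\mathcal O_\infty Y$, of antifield number $-1$,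 commuting with total derivatives, with $\delta_N c^a=\mathcal E^a$; put $\Delta^{r_i}=\delta_Nc^{r_i}$ and let $\delta_k$ be its restriction to $\mathcal P_\infty\{k\}$ ($\delta_{-1}=\delta$). Consider the complex $$0\leftarrow \mathrm{Im}\,\delta\leftarrow\mathcal P_\infty\{N\}_1\leftarrow\mathcal P_\infty\{N\}_2\leftarrow\cdots\leftarrow\mathcal P_\infty\{N\}_{N+3}$$ with differential $\delta_N$ and homology $H_*(\delta_N)$. It is called $q$-exact if its homology is trivial in degrees $\le q$. It satisfies the $q$-homology regularity condition if for all $-1\le k<q-2$ every $\delta_k$-cycle $\Phi\in\mathcal P_\infty\{k\}_{k+3}$ is the $\delta_{k+1}$-boundary of an element of $\mathcal P_\infty\{k+1\}_{k+4}$. For $j\ge1$ a Noether identity of stage $j$ is an element $G=\sum G^\Lambda_{r_{j-1}}c^{r_{j-1}}_\Lambda$, $G^\Lambda_{r_{j-1}}\in\mathcal O_\infty Y$, for which there is $H=\sum H^{\Xi\Sigma}_{a\,r_{j-2}}c^a_\Xi c^{r_{j-2}}_\Sigma$ with $$\sum_\Lambda G^\Lambda_{r_{j-1}}d_\Lambda\Big(\sum_\Sigma\Delta^{\Sigma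 r_{j-1}}_{r_{j-2}}c^{r_{j-2}}_\Sigma\Big)+\delta H=0,\qquad(*)$$ where $\sum_\Sigma\Delta^{\Sigma r_{j-1}}_{r_{j-2}}c^{r_{j-2}}_\Sigma$ is the part of $\Delta^{r_{j-1}}$ linear in the jets of $c^{r_{j-2}}$; for $j=0$ it is $G=\sum G_a^\Lambda c^a_\Lambda$ with $\sum G_a^\Lambda d_\Lambda\mathcal E^a=0$. It is trivial if $G$ is $\delta$-exact. Theorem. Suppose that the complex above is $(N+1)$-exact and satisfies the $(N+1)$-homology regularity condition. (i) Assigning to a cycle $\Phi\in\mathcal P_\infty\{N\}_{N+2}$ its part $G$ linear in the jets of $c^{r_N}$ identifies $H_{N+2}(\delta_N)$ bijectively with the group of Noether identities of stage $N+1$ modulo the trivial ones (so that nontrivial homology classes correspond to nontrivial identities) if and only if the $(N+2)$-homology regularity condition holds. (ii) Suppose that $H_{N+2}(\delta_N)$ is finitely generated, i.e. it contains a projective $C^\infty(X)$-module $\mathcal C$ of finite rank such that every element of $H_{N+2}(\delta_N)$ has the form $\sum\Phi^\Xi_r d_\Xi\Delta^r$ with $\Phi_r^\Xi\in\mathcal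 O_\infty Y$ and $\Delta^r\in\mathcal C$. Let $E_{N+1}$ be the vector bundle with $\Gamma(E_{N+1}^*)\cong\mathcal C$. Then the elements of $\mathcal C$ can be represented by cycles $C^\infty(X)$-linearly, and for every such choice of representatives $\Delta^{r_{N+1}}$ the right derivation $\delta_{N+1}=\delta_N+\overleftarrow\partial_{r_{N+1}}\Delta^{r_{N+1}}$ of $\mathcal P_\infty\{N+1\}$ (extending $\delta_N$, commuting with total derivatives, with $c^{r_{N+1}}\mapsto\Delta^{r_{N+1}}$) is nilpotent, and the resulting complex $0\leftarrow\mathrm{Im}\,\delta\leftarrow\mathcal P_\infty\{N+1\}_1\leftarrow\cdots\leftarrow\mathcal P_\infty\{N+1\}_{N+4}$ is $(N+2)$-exact. Nilpotency of a right derivation of this kind of $\mathcal P_\infty\{N+1\}$ (linear over $\mathcal O_\infty Y$, of antifield number $-1$, commuting with total derivatives, with $c^a\mapsto\mathcal E^a$) implies the complete Noether identities of all stages $j\le N+1$: writing its value on $c^{r_j}$ as $\Delta^{r_j}=G^{r_j}+H^{r_j}+\cdots$, with $G^{r_j}$ linear in the jets of $c^{r_{j-1}}$, $H^{r_j}$ bilinear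 in the jets of $c^a$ and $c^{r_{j-2}}$, and the dots involving only bundles of lower stage, the pair $(G^{r_j},H^{r_j})$ satisfies $(*)$ (for $j=0$: $\sum\Delta_a^{\Lambda r}d_\Lambda\mathcal E^a=0$). For $\delta_{N+1}$, every Noether identity of stage $j\le N+1$ is, up to a trivial one, a combination $\sum\Phi^\Xi_{r_j}d_\Xi G^{r_j}$ of the complete ones. -/

import Mathlib

open scoped TensorProduct Manifold ContDiff Topology

universe u

noncomputable section

namespace KoszulTate

/-! ### Total differential operators -/

section Operators

variable (R A : Type u) [CommRing R] [CommRing A] [Algebra ℝ A] [Algebra R A]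
  (V : Set (Derivation ℝ A A))

/-- The relations between functions `a ∈ A` and symbols `∇_v`, `v ∈ V`. -/
inductive OpRel : FreeAlgebra ℝ (A ⊕ V) → FreeAlgebra ℝ (A ⊕ V) → Prop
  | const (t : ℝ) : OpRel (FreeAlgebra.ι ℝ (.inl (algebraMap ℝ A t))) (algebraMap ℝ _ t)
  | add (a b : A) : OpRel (FreeAlgebra.ι ℝ (.inl (a + b)))
      (FreeAlgebra.ι ℝ (.inl a) + FreeAlgebra.ι ℝ (.inl b))
  | mul (a b : A) : OpRel (FreeAlgebra.ι ℝ (.inl (a * b)))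
      (FreeAlgebra.ι ℝ (.inl a) * FreeAlgebra.ι ℝ (.inl b))
  | linear (r s : R) (w v v' : V) (h : w.1 = algebraMap R A r • v.1 + algebraMap R A s • v'.1) :
      OpRel (FreeAlgebra.ι ℝ (.inr w))
        (FreeAlgebra.ι ℝ (.inl (algebraMap R A r)) * FreeAlgebra.ι ℝ (.inr v) +
          FreeAlgebra.ι ℝ (.inl (algebraMap R A s)) * FreeAlgebra.ι ℝ (.inr v'))
  | leibniz (v : V) (a : A) : OpRel (FreeAlgebra.ι ℝ (.inr v) * FreeAlgebra.ι ℝ (.inl a))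
      (FreeAlgebra.ι ℝ (.inl a) * FreeAlgebra.ι ℝ (.inr v) + FreeAlgebra.ι ℝ (.inl (v.1 a)))
  | bracket (w v v' : V) (h : w.1 = ⁅v.1, v'.1⁆) :
      OpRel (FreeAlgebra.ι ℝ (.inr v) * FreeAlgebra.ι ℝ (.inr v'))
        (FreeAlgebra.ι ℝ (.inr v') * FreeAlgebra.ι ℝ (.inr v) + FreeAlgebra.ι ℝ (.inr w))

/-- The ring of total differential operators `∑ a^Λ d_Λ` with coefficients in `A`: the enveloping
ring of the Lie algebra `V` of total derivatives, with coefficients extended to `A`. -/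
def TotalOp : Type u := RingQuot (OpRel R A V)

instance : Ring (TotalOp R A V) := inferInstanceAs (Ring (RingQuot (OpRel R A V)))

instance : Algebra ℝ (TotalOp R A V) := inferInstanceAs (Algebra ℝ (RingQuot (OpRel R A V)))

namespace TotalOp

/-- The projection from the free algebra. -/
def mk : FreeAlgebra ℝ (A ⊕ V) →ₐ[ℝ] TotalOp R A V := RingQuot.mkAlgHom ℝ (OpRel R A V)

variable {R A V}

theorem mk_eq {x y : FreeAlgebra ℝ (A ⊕ V)} (h : OpRel R A V x y) : mk R A V x = mk R A V y :=
  RingQuot.mkAlgHom_rel ℝ h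

variable (R A V)

/-- Functions as operators of order zero. -/
def coeff : A →ₐ[ℝ] TotalOp R A V :=
  AlgHom.ofLinearMap
    { toFun := fun a => mk R A V (FreeAlgebra.ι ℝ (.inl a))
      map_add' := fun a b => by rw [mk_eq (.add a b), map_add]
      map_smul' := fun t a => by
        rw [Algebra.smul_def, mk_eq (.mul _ a), map_mul, mk_eq (.const t), AlgHom.commutes,
          RingHom.id_apply, Algebra.smul_def] }
    (by
      change mk R A V (FreeAlgebra.ι ℝ (.inl 1)) = 1
      rw [← map_one (algebraMap ℝ A), mk_eq (.const 1), map_one, map_one])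
    (fun a b => by
      change mk R A V (FreeAlgebra.ι ℝ (.inl (a * b))) = _
      rw [mk_eq (.mul a b), map_mul]; rfl)

/-- Functions from the base ring as operators of order zero. -/
def base : R →+* TotalOp R A V := (coeff R A V : A →+* TotalOp R A V).comp (algebraMap R A)

/-- The total derivative `d_v` as an operator. -/
def der (v : V) : TotalOp R A V := mk R A V (FreeAlgebra.ι ℝ (.inr v))

variable {R A V}

/-- Operators act on any real vector space in which the defining relations hold. -/
def lift {B : Type*} [Semiring B] [Algebra ℝ B] (f : A →ₐ[ℝ] B) (g : V → B)
    (hlin : ∀ (r s : R) (w v v' : V),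
      w.1 = algebraMap R A r • v.1 + algebraMap R A s • v'.1 →
      g w = f (algebraMap R A r) * g v + f (algebraMap R A s) * g v')
    (hleib : ∀ (v : V) (a : A), g v * f a = f a * g v + f (v.1 a))
    (hbr : ∀ w v v' : V, w.1 = ⁅v.1, v'.1⁆ → g v * g v' = g v' * g v + g w) :
    TotalOp R A V →ₐ[ℝ] B :=
  RingQuot.liftAlgHom ℝ ⟨FreeAlgebra.lift ℝ (Sum.elim f g), by
    intro x y h
    induction h with
    | const t => simp
    | add a b => simp
    | mul a b => simp
    | linear r s w v v' h => simpa using hlin r s w v v' h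
    | leibniz v a => simpa using hleib v a
    | bracket w v v' h => simpa using hbr w v v' h⟩

@[simp] theorem lift_coeff {B : Type*} [Semiring B] [Algebra ℝ B] (f : A →ₐ[ℝ] B) (g : V → B)
    (h1) (h2) (h3) (a : A) : lift (R := R) f g h1 h2 h3 (coeff R A V a) = f a := by
  change RingQuot.liftAlgHom ℝ _ (RingQuot.mkAlgHom ℝ (OpRel R A V) _) = _
  rw [RingQuot.liftAlgHom_mkAlgHom_apply]; simp

@[simp] theorem lift_der {B : Type*} [Semiring B] [Algebra ℝ B] (f : A →ₐ[ℝ] B) (g : V → B)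
    (h1) (h2) (h3) (v : V) : lift (R := R) f g h1 h2 h3 (der R A V v) = g v := by
  change RingQuot.liftAlgHom ℝ _ (RingQuot.mkAlgHom ℝ (OpRel R A V) _) = _
  rw [RingQuot.liftAlgHom_mkAlgHom_apply]; simp

/-- Two homomorphisms agreeing on functions and total derivatives are equal. -/
theorem hom_ext {B : Type*} [Semiring B] [Algebra ℝ B] {f g : TotalOp R A V →ₐ[ℝ] B}
    (h : ∀ a, f (coeff R A V a) = g (coeff R A V a)) (h' : ∀ v, f (der R A V v) = g (der R A V v)) :
    f = g := by
  apply RingQuot.ringQuot_ext'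
  apply FreeAlgebra.hom_ext
  funext x
  rcases x with a | v
  · exact h a
  · exact h' v

theorem der_mul_coeff (v : V) (a : A) :
    der R A V v * coeff R A V a = coeff R A V a * der R A V v + coeff R A V (v.1 a) := by
  have := mk_eq (R := R) (OpRel.leibniz (R := R) v a)
  rw [map_mul, map_add, map_mul] at this
  exact this

theorem der_linear (r s : R) (w v v' : V)
    (h : w.1 = algebraMap R A r • v.1 + algebraMap R A s • v'.1) :
    der R A V w = base R A V r * der R A V v + base R A V s * der R A V v' := by
  have := mk_eq (OpRel.linear r s w v v' h)
  rw [map_add, map_mul, map_mul] at this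
  exact this

theorem der_bracket (w v v' : V) (h : w.1 = ⁅v.1, v'.1⁆) :
    der R A V v * der R A V v' = der R A V v' * der R A V v + der R A V w := by
  have := mk_eq (R := R) (OpRel.bracket (R := R) w v v' h)
  rw [map_mul, map_add, map_mul] at this
  exact this

variable (R A V)

/-- The action of total differential operators on functions. -/
def onFunctions : TotalOp R A V →ₐ[ℝ] Module.End ℝ A :=
  lift (Algebra.lmul ℝ A) (fun v => v.1.toLinearMap)
    (fun r s w v v' h => by ext x; simp [h, Algebra.smul_def])
    (fun v a => by ext x; simp [mul_comm (v.1 a)])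
    (fun w v v' h => by
      ext x
      change v.1 (v'.1 x) = v'.1 (v.1 x) + w.1 x
      rw [h, Derivation.commutator_apply]; ring)


theorem onFunctions_coeff (a x : A) : onFunctions R A V (coeff R A V a) x = a * x := by
  simp [onFunctions]

theorem onFunctions_der (v : V) (x : A) : onFunctions R A V (der R A V v) x = v.1 x := by
  simp [onFunctions]

end TotalOp

/-- The ring `A` of functions is a module over total differential operators. -/
instance : Module (TotalOp R A V) A :=
  Module.compHom A (TotalOp.onFunctions R A V : TotalOp R A V →+* Module.End ℝ A)

/-- The module of total differential operators applied to a generating module `C`: the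
`A`-module of elements `∑ a_c^Λ d_Λ c`, i.e. `TotalOp ⊗_R C` with the right action of `R` on
`TotalOp`. -/
def JetModule (C : Type u) [AddCommGroup C] [Module R C] : Type u :=
  (TotalOp R A V ⊗[ℤ] C) ⧸ Submodule.span (TotalOp R A V)
    {z | ∃ (D : TotalOp R A V) (r : R) (c : C),
      z = (D * TotalOp.base R A V r) ⊗ₜ[ℤ] c - D ⊗ₜ[ℤ] (r • c)}

section
variable (C : Type u) [AddCommGroup C] [Module R C]

instance : AddCommGroup (JetModule R A V C) := inferInstanceAs (AddCommGroup (_ ⧸ _))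

instance : Module (TotalOp R A V) (JetModule R A V C) :=
  inferInstanceAs (Module (TotalOp R A V) (_ ⧸ Submodule.span (TotalOp R A V) _))

/-- The generator `c` (without derivatives). -/
def JetModule.of : C →ₛₗ[TotalOp.base R A V] JetModule R A V C where
  toFun c := Submodule.Quotient.mk ((1 : TotalOp R A V) ⊗ₜ[ℤ] c)
  map_add' c c' := by rw [TensorProduct.tmul_add]; rfl
  map_smul' r c := by
    symm
    change Submodule.Quotient.mk (TotalOp.base R A V r • ((1 : TotalOp R A V) ⊗ₜ[ℤ] c)) = _
    rw [Submodule.Quotient.eq]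
    exact Submodule.subset_span ⟨1, r, c, by simp [TensorProduct.smul_tmul']⟩

variable {R A V C}

/-- The universal property of the module of jets. -/
def JetModule.lift {W : Type*} [AddCommGroup W] [Module (TotalOp R A V) W]
    (f : C →ₛₗ[TotalOp.base R A V] W) : JetModule R A V C →ₗ[TotalOp R A V] W :=
  Submodule.liftQ _
    ({ toFun := TensorProduct.lift (AddMonoidHom.toIntLinearMap
          { toFun := fun D => AddMonoidHom.toIntLinearMap
              { toFun := fun c => D • f c
                map_zero' := by simp
                map_add' := by simp }
            map_zero' := by ext; simp
            map_add' := by intros; ext; simp [add_smul] })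
       map_add' := by simp
       map_smul' := by
        intro D z
        induction z with
        | zero => simp
        | tmul E c => simp [TensorProduct.smul_tmul', mul_smul]
        | add x y hx hy => simp only [smul_add, map_add, hx, hy] } :
      TotalOp R A V ⊗[ℤ] C →ₗ[TotalOp R A V] W)
    (by
      rw [Submodule.span_le]
      rintro _ ⟨D, r, c, rfl⟩
      simp [mul_smul])

@[simp] theorem JetModule.lift_of {W : Type*} [AddCommGroup W] [Module (TotalOp R A V) W]
    (f : C →ₛₗ[TotalOp.base R A V] W) (c : C) : JetModule.lift f (JetModule.of R A V C c) = f c := by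
  change (1 : TotalOp R A V) • f c = f c
  simp

end

end Operators
/-! ### Families of vector bundles and the graded-commutative ring they generate -/

/-- A family of vector bundles over the base, each with an antifield number. A vector bundle `E`
is given by the projective `R`-module of finite rank of sections of its dual `E^*`
(`R` is the ring of smooth functions on the base). -/
structure BundleFamily (R : Type u) [CommRing R] where
  /-- The index set of the family. -/
  ι : Type
  /-- The antifield number of the bundle. -/
  ant : ι → ℕ
  /-- The module of sections of the dual bundle. -/
  mod : ι → ModuleCat.{u} R
  finite : ∀ i, Module.Finite R (mod i)
  projective : ∀ i, Module.Projective R (mod i)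
  /-- The bundle `E` in which the differential operator takes its values. -/
  E : ι
  ant_E : ant E = 1

/-- The family enlarged by one more bundle `K` of antifield number `d`. -/
def BundleFamily.extend {R : Type u} [CommRing R] (B : BundleFamily R) (d : ℕ)
    (K : ModuleCat.{u} R) (hf : Module.Finite R K) (hp : Module.Projective R K) :
    BundleFamily R where
  ι := Option B.ι
  ant i := i.elim d B.ant
  mod i := i.elim K B.mod
  finite i := match i with
    | none => hf
    | some i => B.finite i
  projective i := match i with
    | none => hp
    | some i => B.projective i
  E := some B.E
  ant_E := B.ant_E

section Ring

variable {R : Type u} [CommRing R] (A : Type u) [CommRing A] [Algebra ℝ A] [Algebra R A]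
  (V : Set (Derivation ℝ A A)) (B : BundleFamily R)

/-- The module of graded functions `∑ Φ_a^Λ c^a_Λ` linear in the jets of the `i`-th bundle. -/
abbrev BundleFamily.Jets (i : B.ι) : Type u := JetModule R A V (B.mod i)

/-- The free algebra whose generators are functions and elements of the modules of jets. -/
abbrev PreRing : Type u := FreeAlgebra ℝ (A ⊕ Σ i, B.Jets A V i)

variable {A V B} in
/-- A function as a generator. -/
abbrev preF (a : A) : PreRing A V B := FreeAlgebra.ι ℝ (.inl a)

variable {A V B} in
/-- An element of a module of jets as a generator. -/
abbrev preC (i : B.ι) (x : B.Jets A V i) : PreRing A V B := FreeAlgebra.ι ℝ (.inr ⟨i, x⟩)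

/-- The relations of the free graded-commutative `A`-algebra on the modules of jets; the
Grassmann parity of a generator is its antifield number mod 2. -/
inductive GrRel : PreRing A V B → PreRing A V B → Prop
  | const (t : ℝ) : GrRel (preF (algebraMap ℝ A t)) (algebraMap ℝ _ t)
  | add (a b : A) : GrRel (preF (a + b)) (preF a + preF b)
  | mul (a b : A) : GrRel (preF (a * b)) (preF a * preF b)
  | addC (i : B.ι) (x y : B.Jets A V i) : GrRel (preC i (x + y)) (preC i x + preC i y)
  | smulC (i : B.ι) (a : A) (x : B.Jets A V i) :
      GrRel (preC i (TotalOp.coeff R A V a • x)) (preF a * preC i x)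
  | commF (i : B.ι) (a : A) (x : B.Jets A V i) :
      GrRel (preC i x * preF a) (preF a * preC i x)
  | commC (i j : B.ι) (x : B.Jets A V i) (y : B.Jets A V j) :
      GrRel (preC i x * preC j y) ((-1) ^ (B.ant i * B.ant j) * (preC j y * preC i x))

/-- The ring of graded functions, polynomial in the jets of the bundles of the family `B`. -/
def GrRing : Type u := RingQuot (GrRel A V B)

instance : Ring (GrRing A V B) := inferInstanceAs (Ring (RingQuot (GrRel A V B)))

instance : Algebra ℝ (GrRing A V B) := inferInstanceAs (Algebra ℝ (RingQuot (GrRel A V B)))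

namespace GrRing

/-- The projection from the free algebra. -/
def mk : PreRing A V B →ₐ[ℝ] GrRing A V B := RingQuot.mkAlgHom ℝ (GrRel A V B)

variable {A V B}

theorem mk_eq {x y : PreRing A V B} (h : GrRel A V B x y) : mk A V B x = mk A V B y :=
  RingQuot.mkAlgHom_rel ℝ h

variable (A V B)

/-- Functions as graded functions of antifield number zero. -/
def fn : A →ₐ[ℝ] GrRing A V B :=
  AlgHom.ofLinearMap
    { toFun := fun a => mk A V B (preF a)
      map_add' := fun a b => by rw [mk_eq (.add a b), map_add]
      map_smul' := fun t a => by
        rw [Algebra.smul_def, mk_eq (.mul _ a), map_mul, mk_eq (.const t), AlgHom.commutes,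
          RingHom.id_apply, Algebra.smul_def] }
    (by
      change mk A V B (preF 1) = 1
      rw [← map_one (algebraMap ℝ A), mk_eq (.const 1), map_one, map_one])
    (fun a b => by
      change mk A V B (preF (a * b)) = _
      rw [mk_eq (.mul a b), map_mul]; rfl)

/-- Elements of the module of jets of the `i`-th bundle as graded functions. -/
def jet (i : B.ι) : B.Jets A V i →+ GrRing A V B :=
  AddMonoidHom.mk' (fun x => mk A V B (preC i x)) (fun x y => by rw [mk_eq (.addC i x y), map_add])

variable {A V B}

theorem jet_smul (i : B.ι) (a : A) (x : B.Jets A V i) :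
    jet A V B i (TotalOp.coeff R A V a • x) = fn A V B a * jet A V B i x := by
  have := mk_eq (GrRel.smulC i a x)
  rw [map_mul] at this
  exact this

theorem jet_mul_fn (i : B.ι) (a : A) (x : B.Jets A V i) :
    jet A V B i x * fn A V B a = fn A V B a * jet A V B i x := by
  have := mk_eq (GrRel.commF i a x)
  rw [map_mul, map_mul] at this
  exact this

theorem jet_mul_jet (i j : B.ι) (x : B.Jets A V i) (y : B.Jets A V j) :
    jet A V B i x * jet A V B j y =
      (-1) ^ (B.ant i * B.ant j) * (jet A V B j y * jet A V B i x) := by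
  have := mk_eq (GrRel.commC i j x y)
  rw [map_mul, map_mul, map_mul, map_pow, map_neg, map_one] at this
  exact this

/-- The universal property of the ring of graded functions. -/
def lift {T : Type*} [Ring T] [Algebra ℝ T] (f : A →ₐ[ℝ] T) (g : ∀ i, B.Jets A V i →+ T)
    (hsmul : ∀ i a x, g i (TotalOp.coeff R A V a • x) = f a * g i x)
    (hcomm : ∀ i a x, g i x * f a = f a * g i x)
    (hgr : ∀ i j x y, g i x * g j y = (-1) ^ (B.ant i * B.ant j) * (g j y * g i x)) :
    GrRing A V B →ₐ[ℝ] T :=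
  RingQuot.liftAlgHom ℝ ⟨FreeAlgebra.lift ℝ (Sum.elim f fun z => g z.1 z.2), by
    intro x y h
    induction h with
    | const t => simp
    | add a b => simp
    | mul a b => simp
    | addC i x y => simp
    | smulC i a x => simpa using hsmul i a x
    | commF i a x => simpa using hcomm i a x
    | commC i j x y => simpa using hgr i j x y⟩

@[simp] theorem lift_fn {T : Type*} [Ring T] [Algebra ℝ T] (f : A →ₐ[ℝ] T)
    (g : ∀ i, B.Jets A V i →+ T) (h1) (h2) (h3) (a : A) :
    lift f g h1 h2 h3 (fn A V B a) = f a := by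
  change RingQuot.liftAlgHom ℝ _ (RingQuot.mkAlgHom ℝ (GrRel A V B) _) = _
  rw [RingQuot.liftAlgHom_mkAlgHom_apply]; simp

@[simp] theorem lift_jet {T : Type*} [Ring T] [Algebra ℝ T] (f : A →ₐ[ℝ] T)
    (g : ∀ i, B.Jets A V i →+ T) (h1) (h2) (h3) (i : B.ι) (x : B.Jets A V i) :
    lift f g h1 h2 h3 (jet A V B i x) = g i x := by
  change RingQuot.liftAlgHom ℝ _ (RingQuot.mkAlgHom ℝ (GrRel A V B) _) = _
  rw [RingQuot.liftAlgHom_mkAlgHom_apply]; simp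

/-- Two homomorphisms agreeing on functions and jets are equal. -/
theorem hom_ext {T : Type*} [Semiring T] [Algebra ℝ T] {f g : GrRing A V B →ₐ[ℝ] T}
    (h : ∀ a, f (fn A V B a) = g (fn A V B a))
    (h' : ∀ i x, f (jet A V B i x) = g (jet A V B i x)) : f = g := by
  apply RingQuot.ringQuot_ext'
  apply FreeAlgebra.hom_ext
  funext x
  rcases x with a | ⟨i, x⟩
  · exact h a
  · exact h' i x

/-- Induction on graded functions. -/
theorem induction {p : GrRing A V B → Prop} (hf : ∀ a, p (fn A V B a))
    (hj : ∀ i x, p (jet A V B i x)) (hadd : ∀ f g, p f → p g → p (f + g))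
    (hmul : ∀ f g, p f → p g → p (f * g)) (f : GrRing A V B) : p f := by
  obtain ⟨z, rfl⟩ : ∃ z, mk A V B z = f := RingQuot.mkAlgHom_surjective ℝ (GrRel A V B) f
  induction z using FreeAlgebra.induction with
  | grade0 t =>
    have h := hf (algebraMap ℝ A t)
    rw [AlgHom.commutes] at h
    rwa [AlgHom.commutes]
  | grade1 x =>
    rcases x with a | ⟨i, x⟩
    · exact hf a
    · exact hj i x
  | add a b ha hb => rw [map_add]; exact hadd _ _ ha hb
  | mul a b ha hb => rw [map_mul]; exact hmul _ _ ha hb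

/-! #### Total derivatives of graded functions -/

/-- A total derivative together with the identity, as a homomorphism to dual numbers. -/
def totalDerHom (v : V) : GrRing A V B →ₐ[ℝ] TrivSqZeroExt (GrRing A V B) (GrRing A V B) :=
  lift
    (AlgHom.ofLinearMap
      { toFun := fun a => TrivSqZeroExt.inl (fn A V B a) + TrivSqZeroExt.inr (fn A V B (v.1 a))
        map_add' := fun a b => by ext <;> simp
        map_smul' := fun t a => by ext <;> simp }
      (by ext <;> simp)
      (fun a b => by
        ext
        · simp
        · simp [-map_mul, ← map_mul, mul_comm]))
    (fun i => AddMonoidHom.mk' (fun x => TrivSqZeroExt.inl (jet A V B i x) +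
        TrivSqZeroExt.inr (jet A V B i (TotalOp.der R A V v • x)))
      (fun x y => by ext <;> simp))
    (fun i a x => by
      ext
      · simp [jet_smul]
      · simp [← mul_smul, TotalOp.der_mul_coeff, add_smul]
        simp [mul_smul, jet_smul])
    (fun i a x => by
      ext
      · simp [jet_mul_fn]
      · simp [jet_mul_fn, add_comm])
    (fun i j x y => by
      have hs : ((-1) ^ (B.ant i * B.ant j) : TrivSqZeroExt (GrRing A V B) (GrRing A V B)) =
          TrivSqZeroExt.inl ((-1) ^ (B.ant i * B.ant j)) := by
        rw [← TrivSqZeroExt.inl_pow, TrivSqZeroExt.inl_neg, TrivSqZeroExt.inl_one]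
      rw [hs]
      ext
      · simp [← jet_mul_jet]
      · simp
        rw [jet_mul_jet i j x, jet_mul_jet i j _ y, ← mul_add, add_comm])


theorem fst_totalDerHom (v : V) (f : GrRing A V B) : (totalDerHom v f).fst = f := by
  have : (TrivSqZeroExt.fstHom ℝ _ _).comp (totalDerHom v) = AlgHom.id ℝ (GrRing A V B) :=
    hom_ext (fun a => by simp [totalDerHom]) (fun i x => by simp [totalDerHom])
  exact DFunLike.congr_fun this f

/-- The total derivative `d_v` of graded functions. -/
def totalDer (v : V) : GrRing A V B →ₗ[ℝ] GrRing A V B where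
  toFun f := (totalDerHom v f).snd
  map_add' := by simp
  map_smul' := by simp

@[simp] theorem totalDer_fn (v : V) (a : A) :
    totalDer v (fn A V B a) = fn A V B (v.1 a) := by
  simp [totalDer, totalDerHom]

@[simp] theorem totalDer_jet (v : V) (i : B.ι) (x : B.Jets A V i) :
    totalDer v (jet A V B i x) = jet A V B i (TotalOp.der R A V v • x) := by
  simp [totalDer, totalDerHom]

@[simp] theorem totalDer_mul (v : V) (f g : GrRing A V B) :
    totalDer v (f * g) = totalDer v f * g + f * totalDer v g := by
  simp [totalDer, fst_totalDerHom, add_comm]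

theorem fn_mul_comm (a : A) (f : GrRing A V B) : fn A V B a * f = f * fn A V B a := by
  induction f using GrRing.induction with
  | hf b => rw [← map_mul, mul_comm, map_mul]
  | hj i x => rw [jet_mul_fn]
  | hadd f g hf hg => rw [mul_add, add_mul, hf, hg]
  | hmul f g hf hg => rw [← mul_assoc, hf, mul_assoc, hg, mul_assoc]

variable (A V B)

theorem lmul_fn (a : A) (f : GrRing A V B) :
    ((Algebra.lmul ℝ (GrRing A V B)).comp (fn A V B)) a f = fn A V B a * f := rfl

/-- The action of total differential operators on graded functions. -/
def onGraded : TotalOp R A V →ₐ[ℝ] Module.End ℝ (GrRing A V B) :=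
  TotalOp.lift ((Algebra.lmul ℝ (GrRing A V B)).comp (fn A V B)) (fun v => totalDer v)
    (fun r s w v v' h => by
      ext f
      induction f using GrRing.induction with
      | hf a => simp [h, Algebra.smul_def]
      | hj i x =>
        simp only [totalDer_jet, TotalOp.der_linear r s w v v' h, add_smul, mul_smul, map_add,
          LinearMap.add_apply, Module.End.mul_apply, lmul_fn]
        congr 1 <;> exact jet_smul _ _ _
      | hadd f g hf hg => rw [map_add, hf, hg, map_add]
      | hmul f g hf hg =>
        rw [totalDer_mul, hf, hg]
        simp only [LinearMap.add_apply, Module.End.mul_apply, lmul_fn, totalDer_mul, add_mul, mul_add, mul_assoc]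
        rw [← mul_assoc f (fn A V B (algebraMap R A r)), ← fn_mul_comm,
          ← mul_assoc f (fn A V B (algebraMap R A s)), ← fn_mul_comm]
        simp only [mul_assoc]
        abel)
    (fun v a => by ext f; simp [add_comm])
    (fun w v v' h => by
      ext f
      induction f using GrRing.induction with
      | hf a =>
        simp only [Module.End.mul_apply, LinearMap.add_apply, totalDer_fn, ← map_add]
        congr 1
        rw [h, Derivation.commutator_apply]; ring
      | hj i x =>
        simp only [Module.End.mul_apply, LinearMap.add_apply, totalDer_jet, ← map_add, ← mul_smul,
          ← add_smul, TotalOp.der_bracket w v v' h]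
      | hadd f g hf hg => rw [map_add, hf, hg, map_add]
      | hmul f g hf hg =>
        simp only [Module.End.mul_apply, LinearMap.add_apply, totalDer_mul, map_add] at hf hg ⊢
        rw [hf, hg, add_mul, mul_add]
        abel)

instance : Module (TotalOp R A V) (GrRing A V B) :=
  Module.compHom (GrRing A V B) (onGraded A V B : TotalOp R A V →+* Module.End ℝ (GrRing A V B))

variable {A V B}

theorem coeff_smul (a : A) (f : GrRing A V B) : TotalOp.coeff R A V a • f = fn A V B a * f := by
  change onGraded A V B (TotalOp.coeff R A V a) f = _
  simp [onGraded]

theorem der_smul (v : V) (f : GrRing A V B) : TotalOp.der R A V v • f = totalDer v f := by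
  change onGraded A V B (TotalOp.der R A V v) f = _
  simp [onGraded]

/-! #### The grading by antifield number -/

variable (A V B)

/-- `f` is a product of elements of modules of jets of antifield numbers at most `m`, of total
antifield number `d`. -/
inductive IsMonomial (m : ℕ) : ℕ → GrRing A V B → Prop
  | one : IsMonomial m 0 1
  | mul {d : ℕ} {f : GrRing A V B} (hf : IsMonomial m d f) (i : B.ι) (hi : B.ant i ≤ m)
      (x : B.Jets A V i) : IsMonomial m (d + B.ant i) (f * jet A V B i x)

/-- Graded functions of antifield number `d` involving only bundles of antifield number at most
`m`. In the usual notation these are the elements of `𝒫_∞{m-2}_d`. -/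
def piece (m d : ℕ) : Submodule (TotalOp R A V) (GrRing A V B) :=
  Submodule.span _ {f | IsMonomial A V B m d f}

/-- Graded functions of antifield number `d` (such a function can only involve bundles of
antifield number at most `d`). -/
def chains (d : ℕ) : Submodule (TotalOp R A V) (GrRing A V B) := piece A V B d d

/-- Graded functions `∑ G_r^Λ c^r_Λ` linear in the jets of the bundles of antifield number `d`. -/
def linear (d : ℕ) : Submodule (TotalOp R A V) (GrRing A V B) :=
  Submodule.span _ {f | ∃ i, B.ant i = d ∧ ∃ x, f = jet A V B i x}

/-- Graded functions `∑ H_{ar}^{ΛΣ} c^a_Λ c^r_Σ` bilinear in the jets of `E` (antifield number 1)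
and the jets of the bundles of antifield number `d`. -/
def bilinear (d : ℕ) : Submodule (TotalOp R A V) (GrRing A V B) :=
  Submodule.span _ {f | ∃ i, B.ant i = d ∧ ∃ x y, f = jet A V B B.E x * jet A V B i y}

/-- The inclusion of the ring of a family of bundles into that of the enlarged family. -/
def incl (d : ℕ) (K : ModuleCat.{u} R) (hf : Module.Finite R K) (hp : Module.Projective R K) :
    GrRing A V B →ₐ[ℝ] GrRing A V (B.extend d K hf hp) :=
  lift (fn A V (B.extend d K hf hp)) (fun i => jet A V (B.extend d K hf hp) (some i))
    (fun i a x => jet_smul (B := B.extend d K hf hp) (some i) a x)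
    (fun i a x => jet_mul_fn (B := B.extend d K hf hp) (some i) a x)
    (fun i j x y => jet_mul_jet (B := B.extend d K hf hp) (some i) (some j) x y)

end GrRing

/-! ### The Koszul-Tate differentials -/

section Differential

open GrRing

variable {A B} (𝓔 : B.mod B.E →ₗ[R] A)

/-- The components `d_Λ 𝓔^a` of the operator: the map sending `c^a_Λ` to `d_Λ 𝓔^a`. -/
def jetOperator : B.Jets A V B.E →ₗ[TotalOp R A V] A :=
  JetModule.lift
    { toFun := 𝓔
      map_add' := map_add 𝓔
      map_smul' := fun r c => by
        change _ = TotalOp.onFunctions R A V (TotalOp.coeff R A V (algebraMap R A r)) (𝓔 c)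
        rw [TotalOp.onFunctions_coeff, map_smul, Algebra.smul_def] }

/-- `jetOperator` on the jets of `E`, zero on the jets of the other bundles. -/
def operatorAt (i : B.ι) : B.Jets A V i →ₗ[TotalOp R A V] A := by
  classical
  exact if h : i = B.E then by subst h; exact jetOperator V 𝓔 else 0


theorem operatorAt_of_ne (i : B.ι) (h : i ≠ B.E) : operatorAt V 𝓔 i = 0 := by
  simp [operatorAt, h]

theorem operatorAt_E : operatorAt V 𝓔 B.E = jetOperator V 𝓔 := by
  simp [operatorAt]

/-- The matrix of a generator `x` on which the differential takes the value `a`. -/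
def genMatrix (n : ℕ) (x a : GrRing A V B) : Matrix (Fin 2) (Fin 2) (GrRing A V B) :=
  !![x, a; 0, (-1) ^ n * x]

/-- The matrix of a function. -/
def fnMatrix (a : A) : Matrix (Fin 2) (Fin 2) (GrRing A V B) :=
  !![fn A V B a, 0; 0, fn A V B a]

theorem genMatrix_add (n : ℕ) (x y a b : GrRing A V B) :
    genMatrix V n (x + y) (a + b) = genMatrix V n x a + genMatrix V n y b := by
  simp [genMatrix, mul_add]

theorem fnMatrix_mul (a b : A) :
    fnMatrix (B := B) V (a * b) = fnMatrix V a * fnMatrix V b := by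
  simp [fnMatrix]

theorem fnMatrix_mul_genMatrix (n : ℕ) (c : A) (x a : GrRing A V B) :
    fnMatrix V c * genMatrix V n x a = genMatrix V n (fn A V B c * x) (fn A V B c * a) := by
  simp [fnMatrix, genMatrix, fn_mul_comm, mul_assoc]

theorem genMatrix_mul_fnMatrix (n : ℕ) (c : A) (x a : GrRing A V B) :
    genMatrix V n x a * fnMatrix V c = fnMatrix V c * genMatrix V n x a := by
  simp [fnMatrix, genMatrix, fn_mul_comm, mul_assoc]

theorem neg_one_pow_mul_matrix (k : ℕ) (x y z w : GrRing A V B) :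
    (-1) ^ k * !![x, y; z, w] =
      !![(-1) ^ k * x, (-1) ^ k * y; (-1) ^ k * z, (-1) ^ k * w] := by
  rcases Nat.even_or_odd k with h | h <;> simp [h.neg_one_pow]

theorem genMatrix_mul_genMatrix (m n : ℕ) (x y a b : GrRing A V B)
    (h : x * y = (-1) ^ (m * n) * (y * x))
    (h' : x * b + a * ((-1) ^ n * y) = (-1) ^ (m * n) * (y * a + b * ((-1) ^ m * x))) :
    genMatrix V m x a * genMatrix V n y b =
      (-1) ^ (m * n) * (genMatrix V n y b * genMatrix V m x a) := by
  have e : (-1) ^ m * x * ((-1) ^ n * y) = (-1) ^ (m * n) * ((-1) ^ n * y * ((-1) ^ m * x)) := by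
    rcases Nat.even_or_odd m with hm | hm <;> rcases Nat.even_or_odd n with hn | hn <;>
      simp [hm.neg_one_pow, hn.neg_one_pow, h]
  rw [genMatrix, genMatrix, Matrix.mul_fin_two, Matrix.mul_fin_two, neg_one_pow_mul_matrix]
  simp only [mul_zero, zero_mul, add_zero, zero_add, h, h', e]

theorem operatorAt_parity (i j : B.ι) (x : B.Jets A V i) (y : B.Jets A V j) :
    jet A V B i x * fn A V B (operatorAt V 𝓔 j y) +
        fn A V B (operatorAt V 𝓔 i x) * ((-1) ^ B.ant j * jet A V B j y) =
      (-1) ^ (B.ant i * B.ant j) * (jet A V B j y * fn A V B (operatorAt V 𝓔 i x) +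
        fn A V B (operatorAt V 𝓔 j y) * ((-1) ^ B.ant i * jet A V B i x)) := by
  by_cases hi : i = B.E
  · subst hi
    by_cases hj : j = B.E
    · subst hj
      simp [B.ant_E, fn_mul_comm]
    · simp [B.ant_E, operatorAt_of_ne V 𝓔 j hj]
      rcases Nat.even_or_odd (B.ant j) with h | h <;> simp [h.neg_one_pow, fn_mul_comm]
  · by_cases hj : j = B.E
    · subst hj
      simp [B.ant_E, operatorAt_of_ne V 𝓔 i hi]
      rcases Nat.even_or_odd (B.ant i) with h | h <;> simp [h.neg_one_pow, fn_mul_comm]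
    · simp [operatorAt_of_ne V 𝓔 j hj, operatorAt_of_ne V 𝓔 i hi]

/-- The differential of the operator together with the identity and the parity automorphism, as a
homomorphism to upper triangular matrices. -/
def koszulHom : GrRing A V B →ₐ[ℝ] Matrix (Fin 2) (Fin 2) (GrRing A V B) :=
  lift
    (AlgHom.ofLinearMap
      { toFun := fun a => fnMatrix V a
        map_add' := fun a b => by simp [fnMatrix]
        map_smul' := fun t a => by simp [fnMatrix] }
      (by
        ext i j
        fin_cases i <;> fin_cases j <;> simp [fnMatrix])
      (fnMatrix_mul V))
    (fun i => AddMonoidHom.mk'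
      (fun x => genMatrix V (B.ant i) (jet A V B i x) (fn A V B (operatorAt V 𝓔 i x)))
      (fun x y => by rw [map_add, map_add, map_add, genMatrix_add]))
    (fun i a x => by
      have h : fn A V B (operatorAt V 𝓔 i (TotalOp.coeff R A V a • x)) =
          fn A V B a * fn A V B (operatorAt V 𝓔 i x) := by
        rw [map_smul, ← map_mul]
        exact congrArg (fn A V B) (TotalOp.onFunctions_coeff R A V a _)
      simp only [AddMonoidHom.mk'_apply, AlgHom.ofLinearMap_apply, LinearMap.coe_mk, AddHom.coe_mk]
      rw [h, jet_smul, fnMatrix_mul_genMatrix])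
    (fun i a x => genMatrix_mul_fnMatrix V _ a _ _)
    (fun i j x y => genMatrix_mul_genMatrix V _ _ _ _ _ _ (jet_mul_jet i j x y)
      (operatorAt_parity V 𝓔 i j x y))

/-- The Koszul-Tate differential `δ` of the operator `𝓔`, acting on the right: it sends `c^a_Λ` to
`d_Λ 𝓔^a` and vanishes on functions and on the jets of the other bundles. -/
def koszul : GrRing A V B →ₗ[ℝ] GrRing A V B where
  toFun f := koszulHom V 𝓔 f 0 1
  map_add' := by simp
  map_smul' := by simp

/-- The trivial Noether identities of stage `j`: the `δ`-exact graded
functions `G` linear in the bundle of antifield number `j + 1`. -/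
def trivialIdentities (j : ℕ) : AddSubgroup (GrRing A V B) :=
  (linear A V B (j + 1)).toAddSubgroup ⊓
    (chains A V B (j + 2)).toAddSubgroup.map (koszul V 𝓔).toAddMonoidHom

/-- A graded derivation (acting on the right) of the ring of graded functions, of antifield
number `-1`, which is linear over functions, commutes with total derivatives, and on the jets of
`E` is given by the operator `𝓔`. It is determined by its values `Δ^r` on the generators `c^r`, and
sends `c^r_Λ` to `d_Λ Δ^r`. -/
structure Differential where
  toLin : GrRing A V B →ₗ[TotalOp R A V] GrRing A V B
  map_mul' : ∀ (d : ℕ) (f g : GrRing A V B), g ∈ chains A V B d →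
    toLin (f * g) = (-1) ^ d * (toLin f * g) + f * toLin g
  map_chains' : ∀ (d : ℕ) (f : GrRing A V B), f ∈ chains A V B (d + 1) → toLin f ∈ chains A V B d
  map_E' : ∀ c : B.mod B.E, toLin (jet A V B B.E (JetModule.of R A V _ c)) = fn A V B (𝓔 c)

namespace Differential

variable {V 𝓔} (D : Differential V 𝓔)

/-- The value `Δ(c)` of the differential on a generator `c` of the `i`-th bundle. -/
def onGen (i : B.ι) (c : B.mod i) : GrRing A V B :=
  D.toLin (jet A V B i (JetModule.of R A V _ c))

/-- Nilpotency. -/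
def Nilpotent : Prop := ∀ f, D.toLin (D.toLin f) = 0

/-- Cycles of antifield number `d`. -/
def cycles (d : ℕ) : Submodule (TotalOp R A V) (GrRing A V B) :=
  LinearMap.ker D.toLin ⊓ chains A V B d

/-- Boundaries of antifield number `d`. -/
def boundaries (d : ℕ) : Submodule (TotalOp R A V) (GrRing A V B) :=
  (chains A V B (d + 1)).map D.toLin

/-- The homology `H_d` in antifield number `d`. -/
abbrev Homology (d : ℕ) : Type u := D.cycles d ⧸ (D.boundaries d).submoduleOf (D.cycles d)

/-- The homology class of a cycle. -/
abbrev cls (d : ℕ) : D.cycles d →ₗ[TotalOp R A V] D.Homology d :=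
  ((D.boundaries d).submoduleOf (D.cycles d)).mkQ

/-- The complex `0 ← Im δ ← 𝒫_1 ← 𝒫_2 ← ⋯` is `q`-exact: its homology of antifield number at most
`q` is trivial. (At `Im δ` it is exact by definition.) -/
def Exact (q : ℕ) : Prop := ∀ d, 1 ≤ d → d ≤ q → D.cycles d ≤ D.boundaries d

/-- The `q`-homology regularity condition: for `k < q - 2`, `k ≥ -1`, every `δ_k`-cycle in
`𝒫_∞{k}_{k+3}` is the `δ_{k+1}`-boundary of an element of `𝒫_∞{k+1}_{k+4}` (below, `m = k + 2` is the
largest antifield number of the bundles which occur in `𝒫_∞{k}`). -/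
def Regular (q : ℕ) : Prop :=
  ∀ m, 1 ≤ m → m < q → ∀ Φ ∈ piece A V B m (m + 1), D.toLin Φ = 0 →
    ∃ Ψ ∈ piece A V B (m + 1) (m + 2), D.toLin Ψ = Φ

/-- The reduction condition of stage `j` on `G`, linear in the bundle of antifield number `j + 1`:
* `j = 0`: `∑ G_a^Λ d_Λ 𝓔^a = 0`;
* `j ≥ 1`: `∑ G_{r}^Λ d_Λ (∑ Δ^{Σ r}_{r'} c^{r'}_Σ) + δ (∑ H_{a r'}^{ΞΣ} c^a_Ξ c^{r'}_Σ) = 0`, where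
  `L = ∑ G_{r}^Λ d_Λ (∑ Δ^{Σ r}_{r'} c^{r'}_Σ)` is the part of `∑ G_r^Λ d_Λ Δ^r` which is linear in the
  bundle of antifield number `j`. -/
def NoetherCondition : ℕ → GrRing A V B → GrRing A V B → Prop
  | 0, G, H => G ∈ linear A V B 1 ∧ H = 0 ∧ koszul V 𝓔 G = 0
  | j + 1, G, H => G ∈ linear A V B (j + 2) ∧ H ∈ bilinear A V B (j + 1) ∧
      ∃ L ∈ linear A V B (j + 1), ∃ h ∈ piece A V B j (j + 1),
        D.toLin G = L + h ∧ L + koszul V 𝓔 H = 0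

theorem NoetherCondition.add {j : ℕ} {G H G' H' : GrRing A V B} (h : D.NoetherCondition j G H)
    (h' : D.NoetherCondition j G' H') : D.NoetherCondition j (G + G') (H + H') := by
  cases j with
  | zero =>
    obtain ⟨h1, h2, h3⟩ := h
    obtain ⟨h1', h2', h3'⟩ := h'
    exact ⟨add_mem h1 h1', by rw [h2, h2', add_zero], by rw [map_add, h3, h3', add_zero]⟩
  | succ j =>
    obtain ⟨h1, h2, L, hL, k, hk, e, e'⟩ := h
    obtain ⟨h1', h2', L', hL', k', hk', f, f'⟩ := h'
    refine ⟨add_mem h1 h1', add_mem h2 h2', L + L', add_mem hL hL', k + k', add_mem hk hk', ?_, ?_⟩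
    · rw [map_add, e, f]; abel
    · rw [map_add, add_add_add_comm, e', f', add_zero]

theorem NoetherCondition.zero (j : ℕ) : D.NoetherCondition j 0 0 := by
  cases j with
  | zero => exact ⟨zero_mem _, rfl, map_zero _⟩
  | succ j => exact ⟨zero_mem _, zero_mem _, 0, zero_mem _, 0, zero_mem _, by simp, by simp⟩

theorem NoetherCondition.neg {j : ℕ} {G H : GrRing A V B} (h : D.NoetherCondition j G H) :
    D.NoetherCondition j (-G) (-H) := by
  cases j with
  | zero =>
    obtain ⟨h1, h2, h3⟩ := h
    exact ⟨neg_mem h1, by rw [h2, neg_zero], by rw [map_neg, h3, neg_zero]⟩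
  | succ j =>
    obtain ⟨h1, h2, L, hL, k, hk, e, e'⟩ := h
    refine ⟨neg_mem h1, neg_mem h2, -L, neg_mem hL, -k, neg_mem hk, ?_, ?_⟩
    · rw [map_neg, e, neg_add]
    · rw [map_neg, ← neg_add, e', neg_zero]

/-- The Noether identities of stage `j`: the graded functions `G` which satisfy a reduction
condition of stage `j`. -/
def noetherIdentities (j : ℕ) : AddSubgroup (GrRing A V B) where
  carrier := {G | ∃ H, D.NoetherCondition j G H}
  add_mem' := fun ⟨_, h⟩ ⟨_, h'⟩ => ⟨_, h.add D h'⟩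
  zero_mem' := ⟨0, .zero D j⟩
  neg_mem' := fun ⟨_, h⟩ => ⟨_, h.neg D⟩

/-- Noether identities of stage `j` modulo the trivial ones. -/
abbrev NoetherClasses (j : ℕ) : Type u :=
  D.noetherIdentities j ⧸ (trivialIdentities V 𝓔 j).addSubgroupOf (D.noetherIdentities j)

/-- The Noether identities of stage `j` are identified with the elements of the homology
`H_{j+1}` (the nontrivial ones with the nonzero elements), by assigning to a cycle its part `G`
linear in the bundle of antifield number `j + 1`. -/
def NoetherIdentified (j : ℕ) : Prop :=
  ∃ e : D.Homology (j + 1) ≃+ D.NoetherClasses j, ∀ Φ : D.cycles (j + 1),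
    ∃ G : D.noetherIdentities j, (Φ - G : GrRing A V B) ∈ piece A V B j (j + 1) ∧
      e (D.cls (j + 1) Φ) = QuotientAddGroup.mk G

/-- `Δ^r = G + H + ⋯` is the value of the differential on a generator of the bundle of antifield
number `j + 2`, where `G` is linear in the bundle of antifield number `j + 1`, the term `H` is
bilinear in `E` and in the bundle of antifield number `j`, and the other terms involve only bundles
of smaller antifield number. -/
def IsNoetherOperator (j : ℕ) (Δ G H : GrRing A V B) : Prop :=
  (∃ i, B.ant i = j + 2 ∧ ∃ c, Δ = D.onGen i c) ∧ G ∈ linear A V B (j + 1) ∧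
    (Δ - G - H) ∈ piece A V B (j - 1) (j + 1)

/-- The complete Noether identities of stages `j ≤ s` hold: the coefficients of the values of the
differential on the bundles of antifield number `j + 2` satisfy the reduction conditions. -/
def CompleteNoetherIdentities (s : ℕ) : Prop :=
  ∀ j ≤ s, ∀ i, B.ant i = j + 2 → ∀ c, ∃ G H, D.IsNoetherOperator j (D.onGen i c) G H ∧
    D.NoetherCondition j G H

/-- Every Noether identity of stage `j ≤ s` is, up to a trivial one, a combination
`∑ Φ_r^Ξ d_Ξ G^r` of the complete ones. -/
def NoetherIdentitiesGenerated (s : ℕ) : Prop :=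
  ∀ j ≤ s, ∀ G ∈ D.noetherIdentities j,
    ∃ G₀ ∈ Submodule.span (TotalOp R A V)
      {G' | ∃ Δ H, D.IsNoetherOperator j Δ G' H ∧ D.NoetherCondition j G' H},
      G - G₀ ∈ trivialIdentities V 𝓔 j

/-- Maps of an `R`-module `K` to the homology in antifield number `d`, linear over `R`. -/
abbrev HomologyMap (d : ℕ) (K : ModuleCat.{u} R) : Type u :=
  K →ₛₗ[TotalOp.base R A V] D.Homology d

/-- Maps of an `R`-module `K` to the cycles of antifield number `d`, linear over `R`. -/
abbrev CycleMap (d : ℕ) (K : ModuleCat.{u} R) : Type u :=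
  K →ₛₗ[TotalOp.base R A V] D.cycles d

/-- The homology in antifield number `d` is generated through the `R`-module `K`, embedded in it
by `κ`: every element is of the form `∑ Φ_r^Ξ d_Ξ Δ^r` with `Δ^r` in the image of `K`. -/
def IsGeneratedThrough {d : ℕ} {K : ModuleCat.{u} R} (κ : D.HomologyMap d K) : Prop :=
  Function.Injective κ ∧ Submodule.span (TotalOp R A V) (Set.range κ) = ⊤

/-- `Δ` assigns to every element of `K` a cycle representing its image under `κ`. -/
def Represents {d : ℕ} {K : ModuleCat.{u} R} (Δ : D.CycleMap d K) (κ : D.HomologyMap d K) : Prop :=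
  ∀ c, D.cls d (Δ c) = κ c

/-- `D'` is the differential `D + ∂_r Δ^r` on the ring of the family enlarged by the bundle `K` of
antifield number `d`: it extends `D` and sends the generators `c` of `K` to `Δ c`. -/
def IsExtension {d : ℕ} {K : ModuleCat.{u} R} {hf : Module.Finite R K} {hp : Module.Projective R K}
    (D' : Differential (B := B.extend d K hf hp) V 𝓔) (Δ : K → GrRing A V B) : Prop :=
  (∀ f, D'.toLin (incl A V B d K hf hp f) = incl A V B d K hf hp (D.toLin f)) ∧
    ∀ c : K, D'.onGen none c = incl A V B d K hf hp (Δ c)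

end Differential

end Differential

end Ring

/-! ### Functions on jets of sections and total derivatives -/

section Jets

variable (EX EY : Type*) [NormedAddCommGroup EX] [NormedSpace ℝ EX]
  [NormedAddCommGroup EY] [NormedSpace ℝ EY]

/-- `π : Y → X` is a smooth fiber bundle with typical fiber `F`. -/
def IsSmoothFiberBundle (EF : Type*) [NormedAddCommGroup EF] [NormedSpace ℝ EF]
    {X Y : Type u} (F : Type*) [TopologicalSpace X] [ChartedSpace EX X]
    [TopologicalSpace Y] [ChartedSpace EY Y] [TopologicalSpace F] [ChartedSpace EF F]
    (π : Y → X) : Prop :=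
  ∀ x : X, ∃ e : Bundle.Trivialization F π, x ∈ e.baseSet ∧
    ContMDiffOn 𝓘(ℝ, EY) (𝓘(ℝ, EX).prod 𝓘(ℝ, EF)) ∞ e e.source ∧
    ContMDiffOn (𝓘(ℝ, EX).prod 𝓘(ℝ, EF)) 𝓘(ℝ, EY) ∞ e.toOpenPartialHomeomorph.symm e.target

variable {X Y : Type u} [TopologicalSpace X] [ChartedSpace EX X]
  [TopologicalSpace Y] [ChartedSpace EY Y]

/-- `s` is a smooth section of `π : Y → X` near `x`. -/
def IsSectionAt (π : Y → X) (s : X → Y) (x : X) : Prop :=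
  ∀ᶠ x' in 𝓝 x, ContMDiffAt 𝓘(ℝ, EX) 𝓘(ℝ, EY) ∞ s x' ∧ π (s x') = x'

/-- A point of `X` with a smooth section of `π : Y → X` near it, representing a jet. -/
structure LocalSection (π : Y → X) where
  pt : X
  sec : X → Y
  isSectionAt : IsSectionAt EX EY π sec pt

/-- The space of coordinates of jets of order `r`. -/
abbrev JetSpace (r : ℕ) : Type _ := EX × ((k : Fin (r + 1)) → EX [×(k : ℕ)]→L[ℝ] EY)

variable {EX EY} in
/-- The coordinates of the `r`-jet of a local section in charts of `X` and `Y`: the coordinates of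
the point and the partial derivatives of order at most `r` of the coordinates of the section. -/
def LocalSection.coords {π : Y → X} (j : LocalSection EX EY π) (r : ℕ)
    (φ : OpenPartialHomeomorph X EX) (ψ : OpenPartialHomeomorph Y EY) : JetSpace EX EY r :=
  (φ j.pt, fun k => iteratedFDeriv ℝ k (ψ ∘ j.sec ∘ φ.symm) (φ j.pt))

/-- `f` is a smooth function on the jet manifold of order `r`: near any jet, it is a smooth function
of the coordinates of the `r`-jet. -/
def IsSmoothOfOrder (π : Y → X) (r : ℕ) (f : LocalSection EX EY π → ℝ) : Prop :=
  ∀ j₀ : LocalSection EX EY π, ∃ (U : Set (JetSpace EX EY r)) (F : JetSpace EX EY r → ℝ),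
    IsOpen U ∧ ContDiffOn ℝ ∞ F U ∧
    j₀.coords r (chartAt EX j₀.pt) (chartAt EY (j₀.sec j₀.pt)) ∈ U ∧
    ∀ j : LocalSection EX EY π, j.pt ∈ (chartAt EX j₀.pt).source →
      j.sec j.pt ∈ (chartAt EY (j₀.sec j₀.pt)).source →
      j.coords r (chartAt EX j₀.pt) (chartAt EY (j₀.sec j₀.pt)) ∈ U →
      f j = F (j.coords r (chartAt EX j₀.pt) (chartAt EY (j₀.sec j₀.pt)))

variable {EX EY}

/-- The restriction of jet coordinates to lower order. -/
def JetSpace.trunc {r r' : ℕ} (h : r ≤ r') (p : JetSpace EX EY r') : JetSpace EX EY r :=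
  (p.1, fun k => p.2 ⟨k, by omega⟩)

theorem JetSpace.contDiff_trunc {r r' : ℕ} (h : r ≤ r') :
    ContDiff ℝ ∞ (JetSpace.trunc (EX := EX) (EY := EY) h) := by
  refine contDiff_fst.prodMk (contDiff_pi.2 fun k => ?_)
  exact (ContinuousLinearMap.proj (R := ℝ)
    (φ := fun k : Fin (r' + 1) => EX [×(k : ℕ)]→L[ℝ] EY) ⟨k, by omega⟩).contDiff.comp contDiff_snd

theorem IsSmoothOfOrder.mono {π : Y → X} {r r' : ℕ} (h : r ≤ r') {f : LocalSection EX EY π → ℝ}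
    (hf : IsSmoothOfOrder EX EY π r f) : IsSmoothOfOrder EX EY π r' f := by
  intro j₀
  obtain ⟨U, F, hU, hF, h0, hj⟩ := hf j₀
  refine ⟨JetSpace.trunc h ⁻¹' U, F ∘ JetSpace.trunc h,
    hU.preimage (JetSpace.contDiff_trunc h).continuous,
    hF.comp (JetSpace.contDiff_trunc h).contDiffOn (fun _ hx => hx), h0, ?_⟩
  intro j h1 h2 h3
  exact hj j h1 h2 h3

theorem IsSmoothOfOrder.binop {π : Y → X} {r : ℕ} {f g : LocalSection EX EY π → ℝ}
    (hf : IsSmoothOfOrder EX EY π r f) (hg : IsSmoothOfOrder EX EY π r g) (op : ℝ × ℝ → ℝ)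
    (hop : ContDiff ℝ ∞ op) : IsSmoothOfOrder EX EY π r (fun j => op (f j, g j)) := by
  intro j₀
  obtain ⟨U, F, hU, hF, h0, hj⟩ := hf j₀
  obtain ⟨U', F', hU', hF', h0', hj'⟩ := hg j₀
  refine ⟨U ∩ U', fun p => op (F p, F' p), hU.inter hU', ?_, ⟨h0, h0'⟩, ?_⟩
  · exact hop.comp_contDiffOn
      ((hF.mono Set.inter_subset_left).prodMk (hF'.mono Set.inter_subset_right))
  · intro j h1 h2 h3
    change op (f j, g j) = op (F _, F' _)
    rw [← hj j h1 h2 h3.1, ← hj' j h1 h2 h3.2]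

theorem isSmoothOfOrder_base [IsManifold 𝓘(ℝ, EX) ∞ X] {π : Y → X}
    (g : C^∞⟮𝓘(ℝ, EX), X; ℝ⟯) :
    IsSmoothOfOrder EX EY π 0 (fun j => g j.pt) := by
  intro j₀
  refine ⟨{p | p.1 ∈ (chartAt EX j₀.pt).target}, fun p => g ((chartAt EX j₀.pt).symm p.1),
    (chartAt EX j₀.pt).open_target.preimage continuous_fst, ?_,
    (chartAt EX j₀.pt).map_source (mem_chart_source EX j₀.pt), ?_⟩
  · have h1 : ContMDiffOn 𝓘(ℝ, EX) 𝓘(ℝ, EX) ∞ (chartAt EX j₀.pt).symm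
        (chartAt EX j₀.pt).target := contMDiffOn_chart_symm
    have h2 := (g.contMDiff.comp_contMDiffOn h1).contDiffOn
    exact h2.comp contDiff_fst.contDiffOn (fun _ hp => hp)
  · intro j h1 _ _
    change g j.pt = g ((chartAt EX j₀.pt).symm (chartAt EX j₀.pt j.pt))
    rw [(chartAt EX j₀.pt).left_inv h1]

variable (EX EY)

/-- The ring `𝒪_∞ Y` of smooth functions on jet manifolds of finite order of `π : Y → X`. -/
def jetFunctionSubalgebra (π : Y → X) : Subalgebra ℝ (LocalSection EX EY π → ℝ) where
  carrier := {f | ∃ r, IsSmoothOfOrder EX EY π r f}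
  add_mem' := fun ⟨r, hf⟩ ⟨r', hg⟩ => ⟨max r r',
    (hf.mono (le_max_left r r')).binop (hg.mono (le_max_right r r')) (fun p => p.1 + p.2)
      (contDiff_fst.add contDiff_snd)⟩
  mul_mem' := fun ⟨r, hf⟩ ⟨r', hg⟩ => ⟨max r r',
    (hf.mono (le_max_left r r')).binop (hg.mono (le_max_right r r')) (fun p => p.1 * p.2)
      (contDiff_fst.mul contDiff_snd)⟩
  algebraMap_mem' := fun t => ⟨0, fun _ => ⟨Set.univ, fun _ => t, isOpen_univ, contDiffOn_const,
    trivial, fun _ _ _ _ => rfl⟩⟩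

/-- The ring `𝒪_∞ Y` as a type. -/
def JetFunctions (π : Y → X) : Type u := jetFunctionSubalgebra EX EY π

instance (π : Y → X) : CommRing (JetFunctions EX EY π) :=
  inferInstanceAs (CommRing (jetFunctionSubalgebra EX EY π))

instance (π : Y → X) : Algebra ℝ (JetFunctions EX EY π) :=
  inferInstanceAs (Algebra ℝ (jetFunctionSubalgebra EX EY π))

/-- The ring of smooth functions on the base. -/
abbrev BaseFunctions (X : Type u) [TopologicalSpace X] [ChartedSpace EX X] : Type u :=
  C^∞⟮𝓘(ℝ, EX), X; ℝ⟯

/-- Functions on the base as functions on jets. -/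
def baseToJet [IsManifold 𝓘(ℝ, EX) ∞ X] (π : Y → X) :
    BaseFunctions EX X →+* JetFunctions EX EY π where
  toFun g := ⟨fun j => g j.pt, 0, isSmoothOfOrder_base g⟩
  map_one' := rfl
  map_mul' _ _ := rfl
  map_zero' := rfl
  map_add' _ _ := rfl

instance [IsManifold 𝓘(ℝ, EX) ∞ X] (π : Y → X) :
    Algebra (BaseFunctions EX X) (JetFunctions EX EY π) :=
  (baseToJet EX EY π).toAlgebra

variable {EX EY}

/-- The value of a function on jets at the jet of a local section. -/
def JetFunctions.eval {π : Y → X} (f : JetFunctions EX EY π) : LocalSection EX EY π → ℝ :=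
  f.1

open Classical in
/-- The function `x ↦ f (j^∞_x s)` near the point of a local section `s`. -/
def LocalSection.pullback {π : Y → X} (j : LocalSection EX EY π) (f : LocalSection EX EY π → ℝ)
    (x : X) : ℝ :=
  if h : IsSectionAt EX EY π j.sec x then f ⟨x, j.sec, h⟩ else 0

variable (EX EY)

/-- The total derivatives: the derivations `d_τ` of the ring of functions on jets, where `τ` is a
smooth vector field on `X` and `(d_τ f)(j^∞_x s) = τ(f ∘ j^∞ s)(x)`; in coordinates
`d_τ = ∑ τ^λ d_λ`. -/
def totalDerivatives [IsManifold 𝓘(ℝ, EX) ∞ X] (π : Y → X) :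
    Set (Derivation ℝ (JetFunctions EX EY π) (JetFunctions EX EY π)) :=
  {v | ∃ τ : Cₛ^∞⟮𝓘(ℝ, EX); EX, (TangentSpace 𝓘(ℝ, EX) : X → Type _)⟯,
    ∀ (f : JetFunctions EX EY π) (j : LocalSection EX EY π),
      (v f).eval j = mfderiv 𝓘(ℝ, EX) 𝓘(ℝ, ℝ) (j.pullback f.eval) j.pt (τ j.pt)}

end Jets
end KoszulTate
end

open KoszulTate

/-!
The theorem is a statement about a free graded-commutative algebra with a derivation, and its
proof uses the jet bundle only through the ring of functions and its total derivatives.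

Write `M_d` for the graded functions linear in the bundle of antifield number `d` (`linear`) and
`P_m` for those which involve bundles of antifield number at most `m` (`piece m`). Counting
antifield numbers gives two decompositions: a graded function of antifield number `d + 1` is the
sum of a *leading part* in `M_{d+1}` and an element of `P_d` (`chains_le_linear_sup_piece`), and
an element of `P_{d+1}` of antifield number `d + 2` is the sum of an element of `M_1 · M_{d+1}`
and an element of `P_d` (`piece_le_bilinear_sup_piece`). The leading part is unique, since `M_d`
and `P_m` meet in zero for `m < d`: truncation to `P_m` kills the former and fixes the latter
(`eq_zero_of_mem_linear_of_mem_piece`). Modulo `P_d`, every differential acts on `M_1 · M_{d+1}`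
as the Koszul-Tate differential `δ` of the operator (`map_sub_koszul_mem_piece`).

Hence the leading part of the equation `D Φ = 0` is exactly the reduction condition which defines
Noether identities, so the leading part of a cycle is a Noether identity
(`mem_noetherIdentities_of_cycle`); and the leading part of a boundary `D Ξ`, for `Ξ` without
leading part, is a trivial one (`exists_trivial_of_boundary`). Conversely, for a Noether identity
`G` completed by `H`, the element `D (G + H)` is a cycle in `P_{j-1}`, so the regularity condition
allows `G + H` to be corrected to a cycle (`exists_cycle_of_mem_noetherIdentities`). Thus taking
leading parts induces a surjection of the homology onto Noether classes. Its kernel consists of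
the classes of cycles without leading part, and these vanish precisely under the next regularity
condition (`noetherIdentified_iff_regular`).

For the second part, representatives exist because the generating module is projective. The
extended differential is prescribed on generators (`exists_isExtension`); its square is a
derivation vanishing on generators. In antifield numbers at most `N + 2` it has the same cycles as
`D`, and the additional generators turn the generators of the remaining homology into boundaries
(`exact_of_extension`). Nilpotency on a generator says that its value is a cycle, and the leading
part of this equation is the complete Noether identity (`completeNoetherIdentities`). Finally a
Noether identity is completed to a cycle, which is a boundary `D' Ξ`; the leading part of `Ξ`
contributes a combination of complete identities and the rest a trivial one
(`noetherIdentitiesGenerated_of_exact`).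
-/

namespace KoszulTate

open GrRing

/-! ### Modules over total differential operators -/

section Operators

variable {R A : Type u} [CommRing R] [CommRing A] [Algebra ℝ A] [Algebra R A]
  {V : Set (Derivation ℝ A A)}

theorem TotalOp.induction {p : TotalOp R A V → Prop} (hc : ∀ a, p (TotalOp.coeff R A V a))
    (hd : ∀ v, p (TotalOp.der R A V v)) (hadd : ∀ P Q, p P → p Q → p (P + Q))
    (hmul : ∀ P Q, p P → p Q → p (P * Q)) (P : TotalOp R A V) : p P := by
  obtain ⟨z, rfl⟩ : ∃ z, TotalOp.mk R A V z = P := RingQuot.mkAlgHom_surjective ℝ (OpRel R A V) P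
  induction z using FreeAlgebra.induction with
  | grade0 t =>
    have h := hc (algebraMap ℝ A t)
    rw [AlgHom.commutes] at h
    rwa [AlgHom.commutes]
  | grade1 x =>
    rcases x with a | v
    · exact hc a
    · exact hd v
  | add a b ha hb => rw [map_add]; exact hadd _ _ ha hb
  | mul a b ha hb => rw [map_mul]; exact hmul _ _ ha hb

/-- An additive property which is stable under multiplication by functions and under total
derivatives passes from generators to the submodule they span. -/
theorem TotalOp.span_induction {W : Type*} [AddCommGroup W] [Module (TotalOp R A V) W] {S : Set W}
    {p : W → Prop} (hmem : ∀ w ∈ S, p w) (h0 : p 0) (hadd : ∀ w w', p w → p w' → p (w + w'))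
    (hc : ∀ a w, p w → p (TotalOp.coeff R A V a • w))
    (hd : ∀ v w, p w → p (TotalOp.der R A V v • w)) {w : W}
    (hw : w ∈ Submodule.span (TotalOp R A V) S) : p w := by
  refine Submodule.span_induction (p := fun w _ => p w) hmem h0 (fun w w' _ _ => hadd w w') ?_ hw
  intro P w _ h
  induction P using TotalOp.induction generalizing w with
  | hc a => exact hc a w h
  | hd v => exact hd v w h
  | hadd P Q hP hQ => rw [add_smul]; exact hadd _ _ (hP w ‹_› h) (hQ w ‹_› h)
  | hmul P Q hP hQ =>
    rw [mul_smul]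
    exact hP _ (Submodule.smul_mem _ _ ‹_›) (hQ w ‹_› h)

theorem JetModule.span_range_of (C : Type u) [AddCommGroup C] [Module R C] :
    Submodule.span (TotalOp R A V) (Set.range (JetModule.of R A V C)) = ⊤ := by
  rw [eq_top_iff]
  rintro x -
  obtain ⟨t, rfl⟩ := Submodule.Quotient.mk_surjective _ x
  induction t with
  | zero => exact zero_mem _
  | add s t hs ht => exact add_mem hs ht
  | tmul P c =>
    have h : Submodule.Quotient.mk (P ⊗ₜ[ℤ] c) = P • JetModule.of R A V C c := by
      change _ = Submodule.Quotient.mk (P • ((1 : TotalOp R A V) ⊗ₜ[ℤ] c))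
      rw [TensorProduct.smul_tmul', smul_eq_mul, mul_one]
    rw [h]
    exact Submodule.smul_mem _ _ (Submodule.subset_span ⟨c, rfl⟩)

theorem JetModule.hom_ext {C : Type u} [AddCommGroup C] [Module R C] {W : Type*} [AddCommGroup W]
    [Module (TotalOp R A V) W] {f g : JetModule R A V C →ₗ[TotalOp R A V] W}
    (h : ∀ c, f (JetModule.of R A V C c) = g (JetModule.of R A V C c)) : f = g :=
  LinearMap.ext_on (JetModule.span_range_of C) (by rintro _ ⟨c, rfl⟩; exact h c)

end Operators

/-! ### Graded functions as a module over total differential operators -/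

namespace GrRing

variable {R A : Type u} [CommRing R] [CommRing A] [Algebra ℝ A] [Algebra R A]
  {V : Set (Derivation ℝ A A)} {B B' : BundleFamily R}

theorem smul_fn (P : TotalOp R A V) (a : A) : fn A V B (P • a) = P • fn A V B a := by
  induction P using TotalOp.induction generalizing a with
  | hc b =>
    rw [coeff_smul, ← map_mul]
    exact congrArg (fn A V B) (TotalOp.onFunctions_coeff R A V b a)
  | hd v =>
    rw [der_smul, totalDer_fn]
    exact congrArg (fn A V B) (TotalOp.onFunctions_der R A V v a)
  | hadd P Q hP hQ => rw [add_smul, map_add, hP, hQ, add_smul]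
  | hmul P Q hP hQ => rw [mul_smul, hP, hQ, mul_smul]

theorem smul_jet (P : TotalOp R A V) (i : B.ι) (x : B.Jets A V i) :
    jet A V B i (P • x) = P • jet A V B i x := by
  induction P using TotalOp.induction generalizing x with
  | hc b => rw [coeff_smul, jet_smul]
  | hd v => rw [der_smul, totalDer_jet]
  | hadd P Q hP hQ => rw [add_smul, map_add, hP, hQ, add_smul]
  | hmul P Q hP hQ => rw [mul_smul, hP, hQ, mul_smul]

variable (A V B) in
/-- Functions as graded functions, as a map of modules over total differential operators. -/
noncomputable def fnLin : A →ₗ[TotalOp R A V] GrRing A V B where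
  toFun := fn A V B
  map_add' := map_add _
  map_smul' := smul_fn

variable (A V B) in
/-- Elements of the `i`-th module of jets as graded functions, as a map of modules over total
differential operators. -/
noncomputable def jetLin (i : B.ι) : B.Jets A V i →ₗ[TotalOp R A V] GrRing A V B where
  toFun := jet A V B i
  map_add' := map_add _
  map_smul' P x := smul_jet P i x

/-- A homomorphism which is the identity on functions and commutes with total derivatives on
generators commutes with all total differential operators. -/
theorem map_smul_of_generators (φ : GrRing A V B →ₐ[ℝ] GrRing A V B')
    (hf : ∀ a, φ (fn A V B a) = fn A V B' a)
    (hj : ∀ i x v, φ (jet A V B i (TotalOp.der R A V v • x)) = totalDer v (φ (jet A V B i x)))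
    (P : TotalOp R A V) (f : GrRing A V B) : φ (P • f) = P • φ f := by
  induction P using TotalOp.induction generalizing f with
  | hc b => rw [coeff_smul, coeff_smul, map_mul, hf]
  | hd v =>
    rw [der_smul, der_smul]
    induction f using GrRing.induction with
    | hf a => rw [totalDer_fn, hf, hf, totalDer_fn]
    | hj i x => rw [totalDer_jet, hj]
    | hadd f g hf hg => simp only [map_add, hf, hg]
    | hmul f g hf hg => simp only [totalDer_mul, map_add, map_mul, hf, hg]
  | hadd P Q hP hQ => rw [add_smul, map_add, hP, hQ, add_smul]
  | hmul P Q hP hQ => rw [mul_smul, hP, hQ, mul_smul]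

/-- Every graded function is a sum of functions times products of generators. -/
theorem right_induction {p : GrRing A V B → Prop} (h1 : p 1) (hadd : ∀ f g, p f → p g → p (f + g))
    (hc : ∀ a f, p f → p (TotalOp.coeff R A V a • f))
    (hj : ∀ f i x, p f → p (f * jet A V B i x)) (f : GrRing A V B) : p f := by
  have key : ∀ g f, p f → p (f * g) := by
    intro g
    induction g using GrRing.induction with
    | hf a => intro f hf; rw [← fn_mul_comm, ← coeff_smul]; exact hc a f hf
    | hj i x => intro f hf; exact hj f i x hf
    | hadd g g' hg hg' => intro f hf; rw [mul_add]; exact hadd _ _ (hg f hf) (hg' f hf)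
    | hmul g g' hg hg' => intro f hf; rw [← mul_assoc]; exact hg' _ (hg f hf)
  rw [← one_mul f]
  exact key f 1 h1

/-! ### Products of homogeneous graded functions -/

variable {m m' d e : ℕ} {f g : GrRing A V B}

theorem der_smul_mul (v : V) (f g : GrRing A V B) :
    (TotalOp.der R A V v • f) * g =
      TotalOp.der R A V v • (f * g) - f * (TotalOp.der R A V v • g) := by
  simp only [der_smul, totalDer_mul]; abel

theorem mul_der_smul (v : V) (f g : GrRing A V B) :
    f * (TotalOp.der R A V v • g) =
      TotalOp.der R A V v • (f * g) - (TotalOp.der R A V v • f) * g := by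
  simp only [der_smul, totalDer_mul]; abel

theorem coeff_smul_mul (a : A) (f g : GrRing A V B) :
    (TotalOp.coeff R A V a • f) * g = TotalOp.coeff R A V a • (f * g) := by
  rw [coeff_smul, coeff_smul, mul_assoc]

theorem mul_coeff_smul (a : A) (f g : GrRing A V B) :
    f * (TotalOp.coeff R A V a • g) = TotalOp.coeff R A V a • (f * g) := by
  rw [coeff_smul, coeff_smul, ← mul_assoc, ← fn_mul_comm, mul_assoc]

theorem neg_one_pow_mul_mem (S : Submodule (TotalOp R A V) (GrRing A V B)) (n : ℕ) (hf : f ∈ S) :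
    (-1) ^ n * f ∈ S := by
  rcases Nat.even_or_odd n with h | h
  · simpa [h.neg_one_pow] using hf
  · simpa [h.neg_one_pow] using hf

theorem piece_mono (h : m ≤ m') : piece A V B m d ≤ piece A V B m' d := by
  refine Submodule.span_mono fun f hf => ?_
  change IsMonomial A V B m d f at hf
  induction hf with
  | one => exact .one
  | mul _ i hi x ih => exact .mul ih i (hi.trans h) x

theorem mul_jet_mem_piece (hf : f ∈ piece A V B m d) (i : B.ι) (hi : B.ant i ≤ m)
    (x : B.Jets A V i) : f * jet A V B i x ∈ piece A V B m (d + B.ant i) := by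
  refine TotalOp.span_induction
    (p := fun f => ∀ x : B.Jets A V i, f * jet A V B i x ∈ piece A V B m (d + B.ant i))
    ?_ ?_ ?_ ?_ ?_ hf x
  · exact fun f hf x => Submodule.subset_span (IsMonomial.mul hf i hi x)
  · intro x; rw [zero_mul]; exact zero_mem _
  · intro f g hf hg x; rw [add_mul]; exact add_mem (hf x) (hg x)
  · intro a f hf x; rw [coeff_smul_mul]; exact Submodule.smul_mem _ _ (hf x)
  · intro v f hf x
    rw [der_smul_mul, ← smul_jet]
    exact sub_mem (Submodule.smul_mem _ _ (hf x)) (hf _)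

theorem mul_mem_piece (hf : f ∈ piece A V B m d) (hg : g ∈ piece A V B m e) :
    f * g ∈ piece A V B m (d + e) := by
  refine TotalOp.span_induction
    (p := fun g => ∀ f ∈ piece A V B m d, f * g ∈ piece A V B m (d + e)) ?_ ?_ ?_ ?_ ?_ hg f hf
  · clear hf hg
    intro g hg f hf
    change IsMonomial A V B m e g at hg
    induction hg with
    | one => rwa [mul_one]
    | mul _ i hi x ih => rw [← mul_assoc, ← add_assoc]; exact mul_jet_mem_piece ih i hi x
  · intro f _; rw [mul_zero]; exact zero_mem _
  · intro g g' hg hg' f hf; rw [mul_add]; exact add_mem (hg f hf) (hg' f hf)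
  · intro a g hg f hf; rw [mul_coeff_smul]; exact Submodule.smul_mem _ _ (hg f hf)
  · intro v g hg f hf
    rw [mul_der_smul]
    exact sub_mem (Submodule.smul_mem _ _ (hg f hf)) (hg _ (Submodule.smul_mem _ _ hf))

theorem jet_mem_piece (i : B.ι) (hi : B.ant i ≤ m) (x : B.Jets A V i) :
    jet A V B i x ∈ piece A V B m (B.ant i) := by
  have h := Submodule.subset_span (R := TotalOp R A V)
    (IsMonomial.mul (.one (A := A) (V := V)) i hi x)
  rwa [one_mul, zero_add] at h

theorem jet_mem_chains (i : B.ι) (x : B.Jets A V i) : jet A V B i x ∈ chains A V B (B.ant i) :=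
  jet_mem_piece i le_rfl x

theorem fn_mem_piece (a : A) : fn A V B a ∈ piece A V B m 0 := by
  have h := Submodule.smul_mem _ (TotalOp.coeff R A V a)
    (Submodule.subset_span (R := TotalOp R A V)
      (IsMonomial.one (A := A) (V := V) (B := B) (m := m)))
  rwa [coeff_smul, mul_one] at h

theorem jet_mem_linear (i : B.ι) (x : B.Jets A V i) : jet A V B i x ∈ linear A V B (B.ant i) :=
  Submodule.subset_span ⟨i, rfl, x, rfl⟩

theorem linear_le_chains : linear A V B d ≤ chains A V B d := by
  refine Submodule.span_le.2 ?_
  rintro _ ⟨i, rfl, x, rfl⟩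
  exact jet_mem_chains i x

theorem bilinear_le_piece (hd : 1 ≤ d) : bilinear A V B d ≤ piece A V B d (d + 1) := by
  refine Submodule.span_le.2 ?_
  rintro _ ⟨i, rfl, x, y, rfl⟩
  have h := mul_mem_piece (jet_mem_piece B.E (B.ant_E.trans_le hd) x) (jet_mem_piece i le_rfl y)
  rwa [B.ant_E, add_comm] at h

theorem mul_jet_comm (hf : f ∈ piece A V B m d) (i : B.ι) (x : B.Jets A V i) :
    f * jet A V B i x = (-1) ^ (d * B.ant i) * (jet A V B i x * f) := by
  refine TotalOp.span_induction (p := fun f => ∀ x : B.Jets A V i,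
    f * jet A V B i x = (-1) ^ (d * B.ant i) * (jet A V B i x * f)) ?_ ?_ ?_ ?_ ?_ hf x
  · clear hf
    intro f hf x
    change IsMonomial A V B m d f at hf
    induction hf with
    | one => simp
    | @mul d f _ j hj y ih =>
      rw [mul_assoc, jet_mul_jet, add_mul, pow_add]
      have c : ∀ (n : ℕ) (g h : GrRing A V B), g * ((-1) ^ n * h) = (-1) ^ n * (g * h) := by
        intro n g h
        rcases Nat.even_or_odd n with hn | hn <;> simp [hn.neg_one_pow]
      rw [c, ← mul_assoc f, ih, ← mul_assoc (jet A V B i x), mul_assoc ((-1) ^ (d * B.ant i)),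
        mul_assoc ((-1) ^ (d * B.ant i)), c (B.ant j * B.ant i)]
  · intro x; simp
  · intro f g hf hg x; rw [add_mul, hf, hg, mul_add, mul_add]
  · intro a f hf x
    rw [coeff_smul_mul, hf, mul_coeff_smul]
    rcases Nat.even_or_odd (d * B.ant i) with h | h <;> simp [h.neg_one_pow]
  · intro v f hf x
    rw [der_smul_mul, ← smul_jet, hf, hf, mul_der_smul, smul_jet]
    rcases Nat.even_or_odd (d * B.ant i) with h | h <;> simp [h.neg_one_pow]; abel

end GrRing

namespace GrRing

variable {R A : Type u} [CommRing R] [CommRing A] [Algebra ℝ A] [Algebra R A]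
  {V : Set (Derivation ℝ A A)} {B : BundleFamily R} {m m' d e : ℕ} {f g : GrRing A V B}

/-! ### Decomposition by the bundles which occur -/

variable (A V B) in
/-- The truncation of graded functions to the bundles of antifield number at most `m`: the jets of
the other bundles are replaced by zero. -/
noncomputable def truncHom (m : ℕ) : GrRing A V B →ₐ[ℝ] GrRing A V B :=
  lift (fn A V B) (fun i => if B.ant i ≤ m then jet A V B i else 0)
    (fun i a x => by split_ifs <;> simp [jet_smul])
    (fun i a x => by split_ifs <;> simp [jet_mul_fn])
    (fun i j x y => by split_ifs <;> simp [← jet_mul_jet])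

variable (A V B) in
/-- The truncation as a map of modules over total differential operators. -/
noncomputable def trunc (m : ℕ) : GrRing A V B →ₗ[TotalOp R A V] GrRing A V B where
  toFun := truncHom A V B m
  map_add' := map_add _
  map_smul' := map_smul_of_generators _ (fun a => by simp [truncHom]) (fun i x v => by
    simp only [truncHom, lift_jet]
    split_ifs <;> simp)

theorem trunc_of_mem_piece (h : m' ≤ m) (hf : f ∈ piece A V B m' d) : trunc A V B m f = f := by
  refine LinearMap.eqOn_span (f := trunc A V B m) (g := LinearMap.id) ?_ hf
  clear hf
  intro f hf
  change IsMonomial A V B m' d f at hf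
  change truncHom A V B m f = f
  induction hf with
  | one => exact map_one _
  | mul _ i hi x ih => rw [map_mul, ih]; simp [truncHom, hi.trans h]

theorem trunc_of_mem_linear (h : m < d) (hf : f ∈ linear A V B d) : trunc A V B m f = 0 := by
  refine LinearMap.eqOn_span (f := trunc A V B m) (g := 0) ?_ hf
  rintro _ ⟨i, rfl, x, rfl⟩
  change truncHom A V B m _ = 0
  simp [truncHom, not_le.2 h]

theorem eq_zero_of_mem_linear_of_mem_piece (h : m < d) (hf : f ∈ linear A V B d)
    (hf' : f ∈ piece A V B m e) : f = 0 := by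
  rw [← trunc_of_mem_piece le_rfl hf', trunc_of_mem_linear h hf]

theorem IsMonomial.mono_of_degree_lt (h : IsMonomial A V B m d f) {n : ℕ} (hd : d ≤ n) :
    IsMonomial A V B n d f := by
  induction h with
  | one => exact .one
  | mul _ i _ x ih => exact .mul (ih (by omega)) i (by omega) x

theorem piece_le_chains : piece A V B m d ≤ chains A V B d :=
  Submodule.span_mono fun _ hf => IsMonomial.mono_of_degree_lt hf le_rfl

theorem IsMonomial.eq_one (hpos : ∀ i, 1 ≤ B.ant i) (h : IsMonomial A V B m 0 f) : f = 1 := by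
  generalize hd : 0 = d at h
  cases h with
  | one => rfl
  | mul _ i _ _ => have := hpos i; omega

theorem piece_zero_eq_bot (hpos : ∀ i, 1 ≤ B.ant i) (hd : 1 ≤ d) : piece A V B 0 d = ⊥ := by
  rw [piece, Submodule.span_eq_bot]
  intro f hf
  change IsMonomial A V B 0 d f at hf
  cases hf with
  | one => omega
  | mul _ i hi _ => have := hpos i; omega

theorem chains_le_linear_sup_piece (hpos : ∀ i, 1 ≤ B.ant i) :
    chains A V B (d + 1) ≤ linear A V B (d + 1) ⊔ piece A V B d (d + 1) := by
  refine Submodule.span_le.2 fun f hf => ?_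
  change IsMonomial A V B (d + 1) (d + 1) f at hf
  generalize hn : d + 1 = n at hf
  cases hf with
  | one => omega
  | @mul d' f hf i hi x =>
    rcases Nat.eq_zero_or_pos d' with rfl | h
    · rw [hf.eq_one hpos, one_mul]
      exact Submodule.mem_sup_left (Submodule.subset_span ⟨i, by omega, x, rfl⟩)
    · have := hpos i
      refine Submodule.mem_sup_right ?_
      have h := IsMonomial.mul (hf.mono_of_degree_lt (n := d) (by omega)) i (by omega) x
      exact Submodule.subset_span h

theorem chains_one_le_linear (hpos : ∀ i, 1 ≤ B.ant i) :
    chains A V B 1 ≤ linear A V B 1 := by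
  have h := chains_le_linear_sup_piece (A := A) (V := V) (d := 0) hpos
  rwa [piece_zero_eq_bot hpos le_rfl, sup_bot_eq] at h

theorem linear_mul_linear_mem_bilinear (hE : ∀ i, B.ant i = 1 → i = B.E)
    (hf : f ∈ linear A V B 1) (hg : g ∈ linear A V B d) : f * g ∈ bilinear A V B d := by
  have key : ∀ x : B.Jets A V B.E, ∀ g ∈ linear A V B d,
      jet A V B B.E x * g ∈ bilinear A V B d := by
    intro x g hg
    refine TotalOp.span_induction
      (p := fun g => ∀ x : B.Jets A V B.E, jet A V B B.E x * g ∈ bilinear A V B d)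
      ?_ ?_ ?_ ?_ ?_ hg x
    · rintro _ ⟨i, hi, y, rfl⟩ x
      exact Submodule.subset_span ⟨i, hi, x, y, rfl⟩
    · intro x; rw [mul_zero]; exact zero_mem _
    · intro g g' hg hg' x; rw [mul_add]; exact add_mem (hg x) (hg' x)
    · intro a g hg x; rw [mul_coeff_smul]; exact Submodule.smul_mem _ _ (hg x)
    · intro v g hg x
      rw [mul_der_smul, ← smul_jet]
      exact sub_mem (Submodule.smul_mem _ _ (hg x)) (hg _)
  refine TotalOp.span_induction
    (p := fun f => ∀ g ∈ linear A V B d, f * g ∈ bilinear A V B d) ?_ ?_ ?_ ?_ ?_ hf g hg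
  · rintro _ ⟨i, hi, x, rfl⟩ g hg
    obtain rfl := hE i hi
    exact key x g hg
  · intro g _; rw [zero_mul]; exact zero_mem _
  · intro f f' hf hf' g hg; rw [add_mul]; exact add_mem (hf g hg) (hf' g hg)
  · intro a f hf g hg; rw [coeff_smul_mul]; exact Submodule.smul_mem _ _ (hf g hg)
  · intro v f hf g hg
    rw [der_smul_mul]
    exact sub_mem (Submodule.smul_mem _ _ (hf g hg)) (hf _ (Submodule.smul_mem _ _ hg))

/-- Among the products of antifield number `d + 2` of generators of antifield number at most
`d + 1`, those containing a generator of antifield number `d + 1` contain just one more generator,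
of antifield number one. -/
theorem piece_le_bilinear_sup_piece (hpos : ∀ i, 1 ≤ B.ant i) (hE : ∀ i, B.ant i = 1 → i = B.E) :
    piece A V B (d + 1) (d + 2) ≤ bilinear A V B (d + 1) ⊔ piece A V B d (d + 2) := by
  refine Submodule.span_le.2 fun f hf => ?_
  change IsMonomial A V B (d + 1) (d + 2) f at hf
  generalize hn : d + 2 = n at hf
  cases hf with
  | one => omega
  | @mul d' f hf i hi x =>
    have hi0 := hpos i
    have hf' : f ∈ chains A V B d' := piece_le_chains (Submodule.subset_span hf)
    rcases Nat.eq_or_lt_of_le hi with h | h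
    · -- The last factor has antifield number `d + 1`, and the product of the others has one.
      obtain rfl : d' = 1 := by omega
      refine Submodule.mem_sup_left (linear_mul_linear_mem_bilinear hE
        (chains_one_le_linear hpos hf') ?_)
      rw [← h]
      exact jet_mem_linear i x
    · rcases Nat.eq_or_lt_of_le hi0 with h1 | h1
      · -- The last factor belongs to `E`, so that the others have total antifield number `d + 1`.
        obtain rfl := hE i h1.symm
        obtain rfl : d' = d + 1 := by omega
        obtain ⟨g, hg, k, hk, rfl⟩ := Submodule.mem_sup.1 (chains_le_linear_sup_piece hpos hf')
        rw [add_mul]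
        refine add_mem (Submodule.mem_sup_left ?_) (Submodule.mem_sup_right ?_)
        · rw [mul_jet_comm (linear_le_chains hg)]
          refine neg_one_pow_mul_mem _ _ (linear_mul_linear_mem_bilinear hE ?_ hg)
          rw [h1]
          exact jet_mem_linear _ x
        · exact mul_jet_mem_piece hk B.E (by omega) x
      · refine Submodule.mem_sup_right ?_
        have h := IsMonomial.mul (hf.mono_of_degree_lt (n := d) (by omega)) i (by omega) x
        exact Submodule.subset_span h

theorem exists_decomposition (hpos : ∀ i, 1 ≤ B.ant i) (hE : ∀ i, B.ant i = 1 → i = B.E)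
    (hf : f ∈ chains A V B (d + 2)) :
    ∃ l ∈ linear A V B (d + 2), ∃ h ∈ bilinear A V B (d + 1), ∃ k ∈ piece A V B d (d + 2),
      l + (h + k) = f := by
  obtain ⟨l, hl, g, hg, e⟩ := Submodule.mem_sup.1 (chains_le_linear_sup_piece hpos hf)
  obtain ⟨h, hh, k, hk, e'⟩ := Submodule.mem_sup.1 (piece_le_bilinear_sup_piece hpos hE hg)
  exact ⟨l, hl, h, hh, k, hk, by rw [e', e]⟩

end GrRing

/-! ### Differentials with prescribed values on generators -/

namespace GrRing

variable {R A : Type u} [CommRing R] [CommRing A] [Algebra ℝ A] [Algebra R A]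
  {V : Set (Derivation ℝ A A)} {B : BundleFamily R} {m d : ℕ} {f : GrRing A V B}

theorem mul_neg_one_pow_mul (n : ℕ) (f g : GrRing A V B) :
    f * ((-1) ^ n * g) = (-1) ^ n * (f * g) := by
  rcases Nat.even_or_odd n with h | h <;> simp [h.neg_one_pow]

variable (A V B) in
/-- The parity automorphism: multiplication by `(-1) ^ d` in antifield number `d`. -/
noncomputable def parity : GrRing A V B →ₐ[ℝ] GrRing A V B :=
  lift (fn A V B) (fun i => AddMonoidHom.mk' (fun x => (-1) ^ B.ant i * jet A V B i x)
      (fun x y => by rw [map_add, mul_add]))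
    (fun i a x => by
      simp only [AddMonoidHom.mk'_apply]
      rw [jet_smul, mul_neg_one_pow_mul])
    (fun i a x => by
      simp only [AddMonoidHom.mk'_apply]
      rw [mul_assoc, jet_mul_fn, mul_neg_one_pow_mul])
    (fun i j x y => by
      simp only [AddMonoidHom.mk'_apply]
      rcases Nat.even_or_odd (B.ant i) with h | h <;>
        rcases Nat.even_or_odd (B.ant j) with h' | h' <;>
        simp [h.neg_one_pow, h'.neg_one_pow, jet_mul_jet i j x y])

theorem parity_smul (P : TotalOp R A V) (f : GrRing A V B) :
    parity A V B (P • f) = P • parity A V B f := by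
  refine map_smul_of_generators _ (fun a => by simp [parity]) (fun i x v => ?_) P f
  rcases Nat.even_or_odd (B.ant i) with h | h <;> simp [parity, h.neg_one_pow]

theorem parity_of_mem_piece (hf : f ∈ piece A V B m d) : parity A V B f = (-1) ^ d * f := by
  refine TotalOp.span_induction (p := fun f => parity A V B f = (-1) ^ d * f) ?_ ?_ ?_ ?_ ?_ hf
  · clear hf
    intro f hf
    change IsMonomial A V B m d f at hf
    induction hf with
    | one => simp
    | mul _ i _ x ih =>
      rw [map_mul, ih, pow_add, mul_assoc, mul_assoc, ← mul_neg_one_pow_mul _ _ (jet A V B i x)]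
      simp [parity]
  · simp
  · intro f g hf hg; rw [map_add, hf, hg, mul_add]
  · intro a f hf; rw [parity_smul, hf, mul_coeff_smul]
  · intro v f hf
    rw [parity_smul, hf]
    rcases Nat.even_or_odd d with h | h <;> simp [h.neg_one_pow]

/-- The right derivation with value `s i x` on a generator `jet i x`, together with the identity and
the parity automorphism, as a homomorphism to upper triangular matrices. -/
noncomputable def derivationHom (hpos : ∀ i, 1 ≤ B.ant i)
    (s : ∀ i, B.Jets A V i →ₗ[TotalOp R A V] GrRing A V B)
    (hs : ∀ i x, s i x ∈ chains A V B (B.ant i - 1)) :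
    GrRing A V B →ₐ[ℝ] Matrix (Fin 2) (Fin 2) (GrRing A V B) :=
  lift
    (AlgHom.ofLinearMap
      { toFun := fun a => fnMatrix V a
        map_add' := fun a b => by simp [fnMatrix]
        map_smul' := fun t a => by simp [fnMatrix] }
      (by
        ext i j
        fin_cases i <;> fin_cases j <;> simp [fnMatrix])
      (fnMatrix_mul V))
    (fun i => AddMonoidHom.mk' (fun x => genMatrix V (B.ant i) (jet A V B i x) (s i x))
      (fun x y => by rw [map_add, map_add, genMatrix_add]))
    (fun i a x => by
      simp only [AddMonoidHom.mk'_apply, AlgHom.ofLinearMap_apply, LinearMap.coe_mk, AddHom.coe_mk]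
      rw [(s i).map_smul, coeff_smul, jet_smul, fnMatrix_mul_genMatrix])
    (fun i a x => genMatrix_mul_fnMatrix V _ a _ _)
    (fun i j x y => genMatrix_mul_genMatrix V _ _ _ _ _ _ (jet_mul_jet i j x y) (by
      obtain ⟨m, hm⟩ := Nat.exists_eq_add_of_le' (hpos i)
      obtain ⟨n, hn⟩ := Nat.exists_eq_add_of_le' (hpos j)
      have h1 := mul_jet_comm (hs i x) j y
      have h2 := mul_jet_comm (hs j y) i x
      simp only [hm, hn, Nat.add_sub_cancel] at h1 h2 ⊢
      rw [mul_neg_one_pow_mul, mul_neg_one_pow_mul, h1, h2, mul_add, add_comm]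
      -- Both sides agree because `m + 1` and `n + 1` are the parities of the generators, while `m`
      -- and `n` are those of their values.
      rcases Nat.even_or_odd m with hm | hm <;> rcases Nat.even_or_odd n with hn | hn <;>
        simp [pow_add, pow_mul, add_mul, mul_add, hm.neg_one_pow, hn.neg_one_pow]))

section

variable (hpos : ∀ i, 1 ≤ B.ant i) (s : ∀ i, B.Jets A V i →ₗ[TotalOp R A V] GrRing A V B)
  (hs : ∀ i x, s i x ∈ chains A V B (B.ant i - 1))

theorem derivationHom_fn (a : A) : derivationHom hpos s hs (fn A V B a) = fnMatrix V a :=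
  lift_fn _ _ _ _ _ a

theorem derivationHom_jet (i : B.ι) (x : B.Jets A V i) :
    derivationHom hpos s hs (jet A V B i x) = genMatrix V (B.ant i) (jet A V B i x) (s i x) :=
  lift_jet _ _ _ _ _ i x

theorem derivationHom_diag (f : GrRing A V B) :
    derivationHom hpos s hs f 0 0 = f ∧ derivationHom hpos s hs f 1 0 = 0 ∧
      derivationHom hpos s hs f 1 1 = parity A V B f := by
  induction f using GrRing.induction with
  | hf a => rw [derivationHom_fn]; simp [fnMatrix, parity]
  | hj i x => rw [derivationHom_jet]; simp [genMatrix, parity]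
  | hadd f g hf hg => simp [hf, hg]
  | hmul f g hf hg => simp [Matrix.mul_apply, Fin.sum_univ_two, hf, hg]

theorem derivationHom_mul (f g : GrRing A V B) :
    derivationHom hpos s hs (f * g) 0 1 =
      f * derivationHom hpos s hs g 0 1 + derivationHom hpos s hs f 0 1 * parity A V B g := by
  simp [Matrix.mul_apply, Fin.sum_univ_two, derivationHom_diag]

theorem derivationHom_smul (P : TotalOp R A V) (f : GrRing A V B) :
    derivationHom hpos s hs (P • f) 0 1 = P • derivationHom hpos s hs f 0 1 := by
  induction P using TotalOp.induction generalizing f with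
  | hc a =>
    rw [coeff_smul, coeff_smul, derivationHom_mul, derivationHom_fn]
    simp [fnMatrix]
  | hd v =>
    rw [der_smul, der_smul]
    induction f using GrRing.induction with
    | hf a => rw [totalDer_fn, derivationHom_fn, derivationHom_fn]; simp [fnMatrix]
    | hj i x =>
      rw [totalDer_jet, derivationHom_jet, derivationHom_jet]
      simp [genMatrix, der_smul]
    | hadd f g hf hg => simp only [map_add, Matrix.add_apply, hf, hg]
    | hmul f g hf hg =>
      have h := parity_smul (TotalOp.der R A V v) g
      rw [der_smul, der_smul] at h
      simp only [totalDer_mul, map_add, Matrix.add_apply, derivationHom_mul, hf, hg, h]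
      abel
  | hadd P Q hP hQ => rw [add_smul, map_add, Matrix.add_apply, hP, hQ, add_smul]
  | hmul P Q hP hQ => rw [mul_smul, hP, hQ, mul_smul]

end

/-- A derivation which lowers the antifield number of generators by one lowers the antifield number
of all graded functions, without bringing in further bundles. -/
theorem derivation_mem_piece (hpos : ∀ i, 1 ≤ B.ant i)
    (D : GrRing A V B →ₗ[TotalOp R A V] GrRing A V B) (hone : D 1 = 0)
    (hmul : ∀ f i x, D (f * jet A V B i x) =
      (-1) ^ B.ant i * (D f * jet A V B i x) + f * D (jet A V B i x))
    (hjet : ∀ i x, D (jet A V B i x) ∈ chains A V B (B.ant i - 1))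
    (hf : f ∈ piece A V B m (d + 1)) : D f ∈ piece A V B m d := by
  have key : ∀ n f, IsMonomial A V B m n f → D f ∈ piece A V B m (n - 1) := by
    intro n f hf
    induction hf with
    | one => rw [hone]; exact zero_mem _
    | @mul d f hf i hi x ih =>
      have hi0 := hpos i
      rw [hmul]
      refine add_mem (neg_one_pow_mul_mem _ _ ?_) ?_
      · rcases Nat.eq_zero_or_pos d with rfl | hd
        · rw [hf.eq_one hpos, hone, zero_mul]; exact zero_mem _
        · have h := mul_jet_mem_piece ih i hi x
          rwa [show d - 1 + B.ant i = d + B.ant i - 1 by omega] at h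
      · have h := mul_mem_piece (Submodule.subset_span hf)
          (piece_mono (show B.ant i - 1 ≤ m by omega) (hjet i x))
        rwa [show d + (B.ant i - 1) = d + B.ant i - 1 by omega] at h
  have h : piece A V B m (d + 1) ≤ (piece A V B m d).comap D :=
    Submodule.span_le.2 fun f hf => key (d + 1) f hf
  exact h hf

end GrRing

namespace Differential

variable {R A : Type u} [CommRing R] [CommRing A] [Algebra ℝ A] [Algebra R A]
  {V : Set (Derivation ℝ A A)} {B : BundleFamily R} {𝓔 : B.mod B.E →ₗ[R] A}

/-- The differential with value `s i x` on a generator `jet i x`. -/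
noncomputable def ofGenerators (hpos : ∀ i, 1 ≤ B.ant i)
    (s : ∀ i, B.Jets A V i →ₗ[TotalOp R A V] GrRing A V B)
    (hs : ∀ i x, s i x ∈ chains A V B (B.ant i - 1))
    (hE : ∀ c, s B.E (JetModule.of R A V _ c) = fn A V B (𝓔 c)) : Differential V 𝓔 where
  toLin :=
    { toFun := fun f => derivationHom hpos s hs f 0 1
      map_add' := fun f g => by rw [map_add, Matrix.add_apply]
      map_smul' := derivationHom_smul hpos s hs }
  map_mul' d f g hg := by
    change derivationHom hpos s hs (f * g) 0 1 = _
    rw [derivationHom_mul, parity_of_mem_piece hg, mul_neg_one_pow_mul, add_comm]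
    rfl
  map_chains' d f hf := piece_le_chains <| derivation_mem_piece hpos _
    (by
      change derivationHom hpos s hs 1 0 1 = 0
      simp)
    (fun f i x => by
      change derivationHom hpos s hs (f * jet A V B i x) 0 1 = _
      rw [derivationHom_mul, parity_of_mem_piece (jet_mem_chains i x), mul_neg_one_pow_mul,
        add_comm]
      rfl)
    (fun i x => by
      change derivationHom hpos s hs (jet A V B i x) 0 1 ∈ _
      rw [derivationHom_jet]
      exact hs i x) hf
  map_E' c := by
    change derivationHom hpos s hs _ 0 1 = _
    rw [derivationHom_jet]
    exact hE c

theorem ofGenerators_jet (hpos : ∀ i, 1 ≤ B.ant i)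
    (s : ∀ i, B.Jets A V i →ₗ[TotalOp R A V] GrRing A V B)
    (hs : ∀ i x, s i x ∈ chains A V B (B.ant i - 1))
    (hE : ∀ c, s B.E (JetModule.of R A V _ c) = fn A V B (𝓔 c)) (i : B.ι) (x : B.Jets A V i) :
    (ofGenerators hpos s hs hE).toLin (jet A V B i x) = s i x := by
  change derivationHom hpos s hs _ 0 1 = _
  rw [derivationHom_jet]
  rfl

variable (V 𝓔) in
/-- The Koszul-Tate differential of the operator alone, as a differential with vanishing values on
the generators of higher antifield number. -/
noncomputable def ofOperator (hpos : ∀ i, 1 ≤ B.ant i) : Differential V 𝓔 :=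
  ofGenerators hpos (fun i => fnLin A V B ∘ₗ operatorAt V 𝓔 i)
    (fun i x => by
      by_cases h : i = B.E
      · subst h
        rw [B.ant_E]
        exact fn_mem_piece _
      · rw [operatorAt_of_ne V 𝓔 i h, LinearMap.comp_zero]
        exact zero_mem _)
    (fun c => by
      rw [operatorAt_E]
      change fn A V B (jetOperator V 𝓔 _) = _
      rw [jetOperator, JetModule.lift_of]
      rfl)

theorem ofOperator_toLin (hpos : ∀ i, 1 ≤ B.ant i) (f : GrRing A V B) :
    (ofOperator V 𝓔 hpos).toLin f = koszul V 𝓔 f := by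
  change derivationHom hpos _ _ f 0 1 = koszulHom V 𝓔 f 0 1
  congr 2

theorem koszul_jet_of_ne {i : B.ι} (h : i ≠ B.E) (x : B.Jets A V i) :
    koszul V 𝓔 (jet A V B i x) = 0 := by
  change koszulHom V 𝓔 (jet A V B i x) 0 1 = 0
  simp [koszulHom, genMatrix, operatorAt_of_ne V 𝓔 i h]

variable (D : Differential V 𝓔) {m d : ℕ} {f g : GrRing A V B}

theorem map_one : D.toLin 1 = 0 := by
  have h := D.map_mul' 0 1 1 (Submodule.subset_span .one)
  simpa using h

theorem map_mul_jet (f : GrRing A V B) (i : B.ι) (x : B.Jets A V i) :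
    D.toLin (f * jet A V B i x) =
      (-1) ^ B.ant i * (D.toLin f * jet A V B i x) + f * D.toLin (jet A V B i x) :=
  D.map_mul' _ _ _ (jet_mem_chains i x)

theorem map_jet_mem_chains (hpos : ∀ i, 1 ≤ B.ant i) (i : B.ι) (x : B.Jets A V i) :
    D.toLin (jet A V B i x) ∈ chains A V B (B.ant i - 1) := by
  refine D.map_chains' _ _ ?_
  rw [Nat.sub_add_cancel (hpos i)]
  exact jet_mem_chains i x

theorem map_mem_piece (hpos : ∀ i, 1 ≤ B.ant i) (hf : f ∈ piece A V B m (d + 1)) :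
    D.toLin f ∈ piece A V B m d :=
  derivation_mem_piece hpos D.toLin D.map_one D.map_mul_jet (D.map_jet_mem_chains hpos) hf

theorem map_jet_E (x : B.Jets A V B.E) :
    D.toLin (jet A V B B.E x) = fn A V B (jetOperator V 𝓔 x) := by
  have h : D.toLin ∘ₗ jetLin A V B B.E = fnLin A V B ∘ₗ jetOperator V 𝓔 := by
    refine JetModule.hom_ext fun c => ?_
    refine (D.map_E' c).trans ?_
    change _ = fn A V B (jetOperator V 𝓔 _)
    rw [jetOperator, JetModule.lift_of]
    rfl
  exact LinearMap.congr_fun h x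

/-- The square of a differential is a derivation, so it vanishes if it vanishes on generators. -/
theorem nilpotent_of_jet (hpos : ∀ i, 1 ≤ B.ant i)
    (h : ∀ i x, D.toLin (D.toLin (jet A V B i x)) = 0) : D.Nilpotent := by
  intro f
  induction f using GrRing.right_induction with
  | h1 => rw [D.map_one, map_zero]
  | hadd f g hf hg => rw [map_add, map_add, hf, hg, add_zero]
  | hc a f hf => rw [map_smul, map_smul, hf, smul_zero]
  | hj f i x hf =>
    obtain ⟨n, hn⟩ := Nat.exists_eq_add_of_le' (hpos i)
    have hx := D.map_jet_mem_chains hpos i x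
    rw [hn, Nat.add_sub_cancel] at hx
    have e := D.map_mul' n f _ hx
    have e' : D.toLin (D.toLin f * jet A V B i x) = D.toLin f * D.toLin (jet A V B i x) := by
      rw [D.map_mul_jet, hf, zero_mul, mul_zero, zero_add]
    rw [D.map_mul_jet, hn, map_add, e, h, mul_zero, add_zero]
    -- The two mixed terms `D f * D x` carry the signs `(-1) ^ n` and `(-1) ^ (n + 1)`.
    rcases Nat.even_or_odd n with hn | hn <;> simp [pow_succ, hn.neg_one_pow, e']

end Differential

namespace Differential

variable {R A : Type u} [CommRing R] [CommRing A] [Algebra ℝ A] [Algebra R A]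
  {V : Set (Derivation ℝ A A)} {B : BundleFamily R} {𝓔 : B.mod B.E →ₗ[R] A}
  (D : Differential V 𝓔) {j d : ℕ} {f G H Φ Ψ Ξ : GrRing A V B}

/-! ### Noether identities and cycles -/

theorem koszul_mem_linear (hpos : ∀ i, 1 ≤ B.ant i) (hH : H ∈ bilinear A V B d) :
    koszul V 𝓔 H ∈ linear A V B d := by
  rw [← ofOperator_toLin hpos]
  have h : bilinear A V B d ≤ (linear A V B d).comap (ofOperator V 𝓔 hpos).toLin := by
    refine Submodule.span_le.2 ?_
    rintro _ ⟨i, rfl, x, y, rfl⟩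
    change (ofOperator V 𝓔 hpos).toLin _ ∈ linear A V B (B.ant i)
    rw [map_mul_jet, map_jet_E]
    refine add_mem (neg_one_pow_mul_mem _ _ ?_) ?_
    · rw [← coeff_smul]
      exact Submodule.smul_mem _ _ (jet_mem_linear i y)
    · by_cases h : i = B.E
      · subst h
        rw [map_jet_E, ← fn_mul_comm, ← coeff_smul]
        exact Submodule.smul_mem _ _ (jet_mem_linear _ x)
      · rw [ofOperator_toLin, koszul_jet_of_ne h, mul_zero]
        exact zero_mem _
  exact h hH

/-- On graded functions bilinear in `c^a` and in the bundle of antifield number `d + 1`, the terms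
linear in that bundle are the same for every differential as for `δ`. -/
theorem map_sub_koszul_mem_piece (hpos : ∀ i, 1 ≤ B.ant i) (hE : ∀ i, B.ant i = 1 → i = B.E)
    (hH : H ∈ bilinear A V B (d + 1)) :
    D.toLin H - koszul V 𝓔 H ∈ piece A V B d (d + 1) := by
  rw [← ofOperator_toLin hpos]
  have h : bilinear A V B (d + 1) ≤
      (piece A V B d (d + 1)).comap (D.toLin - (ofOperator V 𝓔 hpos).toLin) := by
    refine Submodule.span_le.2 ?_
    rintro _ ⟨i, hi, x, y, rfl⟩
    change D.toLin _ - (ofOperator V 𝓔 hpos).toLin _ ∈ piece A V B d (d + 1)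
    rw [map_mul_jet, map_mul_jet, map_jet_E, map_jet_E, add_sub_add_left_eq_sub]
    by_cases h : i = B.E
    · subst h
      rw [map_jet_E, map_jet_E, sub_self]
      exact zero_mem _
    · rw [ofOperator_toLin, koszul_jet_of_ne h, mul_zero, sub_zero]
      have hy := D.map_jet_mem_chains hpos i y
      rw [hi, Nat.add_sub_cancel] at hy
      rcases Nat.eq_zero_or_pos d with rfl | hd
      · exact absurd (hE i hi) h
      · have := mul_mem_piece (jet_mem_piece B.E (B.ant_E.trans_le hd) x) hy
        rwa [B.ant_E, add_comm] at this
  exact h hH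

theorem koszul_mem_piece (hpos : ∀ i, 1 ≤ B.ant i) {m : ℕ} (hf : f ∈ piece A V B m (d + 1)) :
    koszul V 𝓔 f ∈ piece A V B m d := by
  rw [← ofOperator_toLin hpos]
  exact map_mem_piece _ hpos hf

theorem koszul_of_mem_linear (hpos : ∀ i, 1 ≤ B.ant i) (hf : f ∈ linear A V B (d + 2)) :
    koszul V 𝓔 f = 0 := by
  rw [← ofOperator_toLin hpos]
  have h : linear A V B (d + 2) ≤ LinearMap.ker (ofOperator V 𝓔 hpos).toLin := by
    refine Submodule.span_le.2 ?_
    rintro _ ⟨i, hi, x, rfl⟩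
    change (ofOperator V 𝓔 hpos).toLin _ = 0
    rw [ofOperator_toLin]
    refine koszul_jet_of_ne (fun h => ?_) x
    rw [h, B.ant_E] at hi
    omega
  exact h hf

theorem map_of_mem_linear_one (hE : ∀ i, B.ant i = 1 → i = B.E) (hpos : ∀ i, 1 ≤ B.ant i)
    (hf : f ∈ linear A V B 1) : D.toLin f = koszul V 𝓔 f := by
  rw [← ofOperator_toLin hpos]
  refine LinearMap.eqOn_span ?_ hf
  rintro _ ⟨i, hi, x, rfl⟩
  obtain rfl := hE i hi
  rw [map_jet_E, map_jet_E]

theorem noetherCondition_zero_of_cycle (hE : ∀ i, B.ant i = 1 → i = B.E) (hpos : ∀ i, 1 ≤ B.ant i)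
    (hG : G ∈ linear A V B 1) (hcyc : D.toLin G = 0) : D.NoetherCondition 0 G 0 :=
  ⟨hG, rfl, by rw [← D.map_of_mem_linear_one hE hpos hG, hcyc]⟩

/-- The terms of `D Φ = 0` which are linear in the bundle of antifield number `j + 1` form the
reduction condition. -/
theorem noetherCondition_of_cycle (hpos : ∀ i, 1 ≤ B.ant i)
    (hE : ∀ i, B.ant i = 1 → i = B.E) (hG : G ∈ linear A V B (j + 2))
    (hH : H ∈ bilinear A V B (j + 1)) (hΨ : Φ - G - H ∈ piece A V B j (j + 2))
    (hcyc : D.toLin Φ = 0) : D.NoetherCondition (j + 1) G H := by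
  obtain ⟨L, hL, h, hh, e⟩ := Submodule.mem_sup.1
    (chains_le_linear_sup_piece hpos (D.map_chains' (j + 1) G (linear_le_chains hG)))
  refine ⟨hG, hH, L, hL, h, hh, e.symm, ?_⟩
  refine eq_zero_of_mem_linear_of_mem_piece (Nat.lt_succ_self j)
    (add_mem hL (koszul_mem_linear hpos hH)) (e := j + 1) ?_
  have e' : L + koszul V 𝓔 H =
      -(h + (D.toLin H - koszul V 𝓔 H) + D.toLin (Φ - G - H)) := by
    rw [map_sub, map_sub, hcyc, ← e]; abel
  rw [e']
  exact neg_mem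
    (add_mem (add_mem hh (D.map_sub_koszul_mem_piece hpos hE hH)) (D.map_mem_piece hpos hΨ))

/-- The part of a cycle linear in the bundle of highest antifield number is a Noether identity. -/
theorem mem_noetherIdentities_of_cycle (hpos : ∀ i, 1 ≤ B.ant i)
    (hE : ∀ i, B.ant i = 1 → i = B.E) (hG : G ∈ linear A V B (j + 1))
    (hΨ : Ψ ∈ piece A V B j (j + 1)) (hcyc : D.toLin (G + Ψ) = 0) :
    G ∈ D.noetherIdentities j := by
  cases j with
  | zero =>
    rw [piece_zero_eq_bot hpos le_rfl, Submodule.mem_bot] at hΨ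
    rw [hΨ, add_zero] at hcyc
    exact ⟨0, D.noetherCondition_zero_of_cycle hE hpos hG hcyc⟩
  | succ j =>
    obtain ⟨H, hH, Ψ', hΨ', rfl⟩ := Submodule.mem_sup.1 (piece_le_bilinear_sup_piece hpos hE hΨ)
    exact ⟨H, D.noetherCondition_of_cycle hpos hE hG hH
      (by rwa [add_sub_cancel_left, add_sub_cancel_left]) hcyc⟩

theorem mem_linear_of_mem_noetherIdentities (hG : G ∈ D.noetherIdentities j) :
    G ∈ linear A V B (j + 1) := by
  obtain ⟨H, h⟩ := hG
  cases j with
  | zero => exact h.1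
  | succ j => exact h.1

/-- Under the homology regularity condition every Noether identity is completed to a cycle: the
reduction condition makes `D (G + H)` a cycle free of the bundle of antifield number `j`, and the
regularity condition makes that cycle a boundary. -/
theorem exists_cycle_of_mem_noetherIdentities (hpos : ∀ i, 1 ≤ B.ant i)
    (hE : ∀ i, B.ant i = 1 → i = B.E) (hnil : D.Nilpotent) (hreg : D.Regular j)
    (hG : G ∈ D.noetherIdentities j) :
    ∃ Ψ ∈ piece A V B j (j + 1), D.toLin (G + Ψ) = 0 := by
  obtain ⟨H, h⟩ := hG
  cases j with
  | zero =>
    exact ⟨0, zero_mem _, by rw [add_zero, D.map_of_mem_linear_one hE hpos h.1, h.2.2]⟩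
  | succ j =>
    obtain ⟨-, hH, L, hL, k, hk, e, e'⟩ := h
    have hb : D.toLin (G + H) ∈ piece A V B j (j + 1) := by
      have e'' : D.toLin (G + H) = k + (D.toLin H - koszul V 𝓔 H) + (L + koszul V 𝓔 H) := by
        rw [map_add, e]; abel
      rw [e'', e', add_zero]
      exact add_mem hk (D.map_sub_koszul_mem_piece hpos hE hH)
    have hH' := bilinear_le_piece (Nat.succ_pos j) hH
    rcases Nat.eq_zero_or_pos j with rfl | hj
    · rw [piece_zero_eq_bot hpos le_rfl, Submodule.mem_bot] at hb
      exact ⟨H, hH', hb⟩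
    · obtain ⟨Ψ, hΨ, hΨe⟩ := hreg j hj (Nat.lt_succ_self j) _ hb (hnil _)
      exact ⟨H - Ψ, sub_mem hH' hΨ, by rw [← add_sub_assoc, map_sub, hΨe, sub_self]⟩

/-- Modulo graded functions free of the bundle of antifield number `j + 1`, the boundaries of graded
functions free of the bundle of antifield number `j + 2` are the trivial Noether identities. -/
theorem exists_trivial_of_boundary (hpos : ∀ i, 1 ≤ B.ant i) (hE : ∀ i, B.ant i = 1 → i = B.E)
    (hΞ : Ξ ∈ piece A V B (j + 1) (j + 2)) :
    ∃ T ∈ trivialIdentities V 𝓔 j, D.toLin Ξ - T ∈ piece A V B j (j + 1) := by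
  obtain ⟨H, hH, Ψ, hΨ, rfl⟩ := Submodule.mem_sup.1 (piece_le_bilinear_sup_piece hpos hE hΞ)
  refine ⟨koszul V 𝓔 H, ⟨koszul_mem_linear hpos hH, H,
    piece_le_chains (bilinear_le_piece (Nat.succ_pos j) hH), rfl⟩, ?_⟩
  rw [map_add, add_sub_right_comm]
  exact add_mem (D.map_sub_koszul_mem_piece hpos hE hH) (D.map_mem_piece hpos hΨ)

theorem exists_boundary_of_trivial (hpos : ∀ i, 1 ≤ B.ant i) (hE : ∀ i, B.ant i = 1 → i = B.E)
    (hG : G ∈ trivialIdentities V 𝓔 j) :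
    ∃ Ξ ∈ piece A V B (j + 1) (j + 2), G - D.toLin Ξ ∈ piece A V B j (j + 1) := by
  obtain ⟨Ξ, hΞ, e⟩ := AddSubgroup.mem_map.1 hG.2
  replace hΞ : Ξ ∈ chains A V B (j + 2) := hΞ
  replace e : koszul V 𝓔 Ξ = G := e
  rw [← e]
  obtain ⟨ℓ, hℓ, H, hH, Ψ, hΨ, rfl⟩ := exists_decomposition hpos hE hΞ
  refine ⟨H, bilinear_le_piece (Nat.succ_pos j) hH, ?_⟩
  rw [map_add, map_add, koszul_of_mem_linear hpos hℓ, zero_add, add_sub_right_comm]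
  refine add_mem ?_ (koszul_mem_piece hpos hΨ)
  rw [← neg_sub]
  exact neg_mem (D.map_sub_koszul_mem_piece hpos hE hH)

/-! ### The homology and the Noether classes -/

theorem sub_trunc_mem_linear (hpos : ∀ i, 1 ≤ B.ant i) (hΦ : Φ ∈ chains A V B (j + 1)) :
    Φ - trunc A V B j Φ ∈ linear A V B (j + 1) ∧ trunc A V B j Φ ∈ piece A V B j (j + 1) := by
  obtain ⟨G, hG, Ψ, hΨ, rfl⟩ := Submodule.mem_sup.1 (chains_le_linear_sup_piece hpos hΦ)
  rw [map_add, trunc_of_mem_linear (Nat.lt_succ_self j) hG, trunc_of_mem_piece le_rfl hΨ, zero_add,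
    add_sub_cancel_right]
  exact ⟨hG, hΨ⟩

/-- The part of a cycle linear in the bundle of highest antifield number, as a Noether identity. -/
noncomputable def leadingPart (hpos : ∀ i, 1 ≤ B.ant i) (hE : ∀ i, B.ant i = 1 → i = B.E) (j : ℕ) :
    D.cycles (j + 1) →+ D.noetherIdentities j where
  toFun Φ := ⟨Φ - trunc A V B j Φ, by
    obtain ⟨hG, hΨ⟩ := sub_trunc_mem_linear hpos Φ.2.2
    refine D.mem_noetherIdentities_of_cycle hpos hE hG hΨ ?_
    rw [sub_add_cancel]
    exact Φ.2.1⟩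
  map_zero' := by ext; simp
  map_add' Φ Φ' := by
    ext
    simp only [Submodule.coe_add, map_add, AddSubgroup.coe_add]
    abel

theorem sub_leadingPart_mem_piece (hpos : ∀ i, 1 ≤ B.ant i) (hE : ∀ i, B.ant i = 1 → i = B.E)
    (Φ : D.cycles (j + 1)) :
    (Φ - D.leadingPart hpos hE j Φ : GrRing A V B) ∈ piece A V B j (j + 1) := by
  change (Φ : GrRing A V B) - (Φ - trunc A V B j Φ) ∈ _
  rw [sub_sub_cancel]
  exact (sub_trunc_mem_linear hpos Φ.2.2).2

/-- If there are no bundles of antifield number above `m`, graded functions of any antifield number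
only involve bundles of antifield number at most `m`. -/
theorem _root_.KoszulTate.GrRing.chains_eq_piece_of_top {m n : ℕ} (htop : ∀ i, B.ant i ≤ m) :
    chains A V B n = piece A V B m n := by
  refine le_antisymm (Submodule.span_mono fun f hf => ?_) piece_le_chains
  have key : ∀ k f, IsMonomial A V B n k f → IsMonomial A V B m k f := by
    intro k f hk
    induction hk with
    | one => exact .one
    | mul _ i _ x ih => exact .mul (ih) i (htop i) x
  exact key n f hf

/-- A cycle is a boundary if and only if its leading part is a trivial Noether identity, provided
that there is no bundle of antifield number above `j + 1` and cycles without leading part are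
boundaries. -/
theorem leadingPart_mem_trivialIdentities_iff (hpos : ∀ i, 1 ≤ B.ant i)
    (hE : ∀ i, B.ant i = 1 → i = B.E) (htop : ∀ i, B.ant i ≤ j + 1) (hj : 1 ≤ j)
    (hnil : D.Nilpotent) (hreg : D.Regular (j + 1)) (Φ : D.cycles (j + 1)) :
    (D.leadingPart hpos hE j Φ : GrRing A V B) ∈ trivialIdentities V 𝓔 j ↔
      (Φ : GrRing A V B) ∈ D.boundaries (j + 1) := by
  have hΨ := D.sub_leadingPart_mem_piece hpos hE Φ
  have hG := D.mem_linear_of_mem_noetherIdentities (D.leadingPart hpos hE j Φ).2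
  generalize (D.leadingPart hpos hE j Φ : GrRing A V B) = G at hΨ hG ⊢
  constructor
  · intro h
    obtain ⟨Ξ, hΞ, h'⟩ := D.exists_boundary_of_trivial hpos hE h
    obtain ⟨Ξ', hΞ', e⟩ := hreg j hj (Nat.lt_succ_self j) (Φ - D.toLin Ξ)
      (by rw [← sub_add_sub_cancel _ G]; exact add_mem hΨ h')
      (by rw [map_sub, hnil, sub_zero]; exact Φ.2.1)
    refine ⟨Ξ + Ξ', piece_le_chains (add_mem hΞ hΞ'), ?_⟩
    rw [map_add, e, add_sub_cancel]
  · rintro ⟨Ξ, hΞ, e⟩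
    change Ξ ∈ chains A V B (j + 2) at hΞ
    rw [chains_eq_piece_of_top htop] at hΞ
    obtain ⟨T, hT, h⟩ := D.exists_trivial_of_boundary hpos hE hΞ
    have e' : G - T = 0 := by
      refine eq_zero_of_mem_linear_of_mem_piece (Nat.lt_succ_self j) (sub_mem hG hT.1)
        (e := j + 1) ?_
      rw [show G - T = (D.toLin Ξ - T) - (Φ - G) by rw [e]; abel]
      exact sub_mem h hΨ
    rwa [sub_eq_zero.1 e']

/-- Noether identities of stage `j` modulo the trivial ones are identified with the homology in
antifield number `j + 1`, where `j + 1` is the highest antifield number of the bundles, if and only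
if the homology regularity condition holds one step further. -/
theorem noetherIdentified_iff_regular (hpos : ∀ i, 1 ≤ B.ant i)
    (hE : ∀ i, B.ant i = 1 → i = B.E) (htop : ∀ i, B.ant i ≤ j + 1) (hj : 1 ≤ j)
    (hnil : D.Nilpotent) (hreg : D.Regular j) : D.NoetherIdentified j ↔ D.Regular (j + 1) := by
  constructor
  · rintro ⟨e, he⟩ m hm hmj Φ hΦ hcyc
    rcases Nat.eq_or_lt_of_le (Nat.le_of_lt_succ hmj) with rfl | h
    · obtain ⟨G, hG, hGe⟩ := he ⟨Φ, hcyc, piece_le_chains hΦ⟩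
      -- A cycle in `piece m` has no leading part.
      have hG0 : G = 0 := by
        ext
        refine eq_zero_of_mem_linear_of_mem_piece (Nat.lt_succ_self m)
          (D.mem_linear_of_mem_noetherIdentities G.2) (e := m + 1) ?_
        rw [← sub_sub_cancel Φ (G : GrRing A V B)]
        exact sub_mem hΦ hG
      rw [hG0, QuotientAddGroup.mk_zero, e.map_eq_zero_iff, Submodule.mkQ_apply,
        Submodule.Quotient.mk_eq_zero] at hGe
      obtain ⟨Ξ, hΞ, hΞe⟩ := hGe
      change Ξ ∈ chains A V B (m + 2) at hΞ
      rw [chains_eq_piece_of_top htop] at hΞ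
      exact ⟨Ξ, hΞ, hΞe⟩
    · exact hreg m hm h Φ hΦ hcyc
  · intro hreg'
    let φ : D.cycles (j + 1) →+ D.NoetherClasses j :=
      (QuotientAddGroup.mk' _).comp (D.leadingPart hpos hE j)
    have hker : ((D.boundaries (j + 1)).submoduleOf (D.cycles (j + 1))).toAddSubgroup = φ.ker := by
      ext Φ
      rw [AddMonoidHom.mem_ker]
      change _ ↔ (QuotientAddGroup.mk (D.leadingPart hpos hE j Φ) : D.NoetherClasses j) = 0
      rw [QuotientAddGroup.eq_zero_iff, AddSubgroup.mem_addSubgroupOf,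
        D.leadingPart_mem_trivialIdentities_iff hpos hE htop hj hnil hreg']
      rfl
    have hsurj : Function.Surjective φ := by
      intro q
      obtain ⟨G, rfl⟩ := QuotientAddGroup.mk_surjective q
      obtain ⟨Ψ, hΨ, hcyc⟩ := D.exists_cycle_of_mem_noetherIdentities hpos hE hnil hreg G.2
      have hG := D.mem_linear_of_mem_noetherIdentities G.2
      refine ⟨⟨G + Ψ, hcyc, add_mem (linear_le_chains hG) (piece_le_chains hΨ)⟩, ?_⟩
      change QuotientAddGroup.mk (D.leadingPart hpos hE j _) = _
      congr 1
      ext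
      change (G + Ψ : GrRing A V B) - trunc A V B j (G + Ψ) = G
      rw [map_add, trunc_of_mem_linear (Nat.lt_succ_self j) hG, trunc_of_mem_piece le_rfl hΨ,
        zero_add, add_sub_cancel_right]
    refine ⟨(QuotientAddGroup.quotientAddEquivOfEq hker).trans
      (QuotientAddGroup.quotientKerEquivOfSurjective φ hsurj), fun Φ =>
      ⟨D.leadingPart hpos hE j Φ, D.sub_leadingPart_mem_piece hpos hE Φ, rfl⟩⟩

/-! ### Complete Noether identities -/

/-- Nilpotency on generators is the statement that their values are cycles, whose leading parts
satisfy the reduction conditions. -/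
theorem completeNoetherIdentities (hpos : ∀ i, 1 ≤ B.ant i) (hE : ∀ i, B.ant i = 1 → i = B.E)
    (hnil : D.Nilpotent) (s : ℕ) : D.CompleteNoetherIdentities s := by
  intro j _ i hi c
  have hΔ : D.onGen i c ∈ chains A V B (j + 1) := by
    have h := D.map_jet_mem_chains hpos i (JetModule.of R A V _ c)
    rwa [hi] at h
  have hcyc : D.toLin (D.onGen i c) = 0 := hnil _
  cases j with
  | zero =>
    refine ⟨D.onGen i c, 0, ⟨⟨i, hi, c, rfl⟩, chains_one_le_linear hpos hΔ, ?_⟩,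
      D.noetherCondition_zero_of_cycle hE hpos (chains_one_le_linear hpos hΔ) hcyc⟩
    rw [sub_self, sub_zero]
    exact zero_mem _
  | succ j =>
    obtain ⟨G, hG, Ψ, hΨ, e⟩ := Submodule.mem_sup.1 (chains_le_linear_sup_piece hpos hΔ)
    obtain ⟨H, hH, Ψ', hΨ', rfl⟩ := Submodule.mem_sup.1 (piece_le_bilinear_sup_piece hpos hE hΨ)
    have h : D.onGen i c - G - H ∈ piece A V B j (j + 2) := by
      rwa [← e, add_sub_cancel_left, add_sub_cancel_left]
    exact ⟨G, H, ⟨⟨i, hi, c, rfl⟩, hG, h⟩, D.noetherCondition_of_cycle hpos hE hG hH h hcyc⟩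

end Differential

namespace Differential

variable {R A : Type u} [CommRing R] [CommRing A] [Algebra ℝ A] [Algebra R A]
  {V : Set (Derivation ℝ A A)} {B : BundleFamily R} {𝓔 : B.mod B.E →ₗ[R] A}
  (D : Differential V 𝓔) {j s : ℕ}

/-- The values of the differential on the bundle of antifield number `j + 2` are combinations of the
complete Noether identities, up to terms free of the bundle of antifield number `j + 1`. -/
theorem map_mem_span_sup_piece (h : D.CompleteNoetherIdentities j) {f : GrRing A V B}
    (hf : f ∈ linear A V B (j + 2)) :
    D.toLin f ∈ Submodule.span (TotalOp R A V)
      {G | ∃ Δ H, D.IsNoetherOperator j Δ G H ∧ D.NoetherCondition j G H} ⊔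
        piece A V B j (j + 1) := by
  set S := Submodule.span (TotalOp R A V)
      {G | ∃ Δ H, D.IsNoetherOperator j Δ G H ∧ D.NoetherCondition j G H} ⊔
        piece A V B j (j + 1) with hS
  have key : linear A V B (j + 2) ≤ S.comap D.toLin := by
    refine Submodule.span_le.2 ?_
    rintro _ ⟨i, hi, x, rfl⟩
    have hx : (⊤ : Submodule (TotalOp R A V) (B.Jets A V i)) ≤
        S.comap (D.toLin ∘ₗ jetLin A V B i) := by
      rw [← JetModule.span_range_of, Submodule.span_le]
      rintro _ ⟨c, rfl⟩
      obtain ⟨G, H, hop, hcond⟩ := h j le_rfl i hi c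
      change D.onGen i c ∈ S
      have hH : H ∈ piece A V B j (j + 1) := by
        cases j with
        | zero => rw [hcond.2.1]; exact zero_mem _
        | succ j => exact bilinear_le_piece (Nat.succ_pos j) hcond.2.1
      rw [← sub_add_cancel (D.onGen i c) G]
      refine add_mem (Submodule.mem_sup_right ?_)
        (Submodule.mem_sup_left (Submodule.subset_span ⟨_, H, hop, hcond⟩))
      rw [← sub_add_cancel (D.onGen i c - G) H]
      exact add_mem (piece_mono (Nat.sub_le j 1) hop.2.2) hH
    exact hx (Submodule.mem_top (x := x))
  exact key hf

/-- If a complex is exact, the cycle completing a Noether identity is a boundary, and the leading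
part of the boundary is a combination of complete Noether identities plus a trivial identity. -/
theorem noetherIdentitiesGenerated_of_exact (hpos : ∀ i, 1 ≤ B.ant i)
    (hE : ∀ i, B.ant i = 1 → i = B.E) (hnil : D.Nilpotent) (hexact : D.Exact (s + 1))
    (hreg : D.Regular s) : D.NoetherIdentitiesGenerated s := by
  intro j hj G hG
  have hGl := D.mem_linear_of_mem_noetherIdentities hG
  obtain ⟨Ψ, hΨ, hcyc⟩ := D.exists_cycle_of_mem_noetherIdentities hpos hE hnil
    (fun m hm hmj => hreg m hm (hmj.trans_le hj)) hG
  obtain ⟨Ξ, hΞ, e⟩ := hexact (j + 1) (Nat.succ_pos j) (Nat.succ_le_succ hj)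
    (show G + Ψ ∈ D.cycles (j + 1) from
      ⟨hcyc, add_mem (linear_le_chains hGl) (piece_le_chains hΨ)⟩)
  obtain ⟨ℓ, hℓ, Ξ, hΞ', rfl⟩ := Submodule.mem_sup.1 (chains_le_linear_sup_piece hpos hΞ)
  obtain ⟨G₀, hG₀, k, hk, e₀⟩ := Submodule.mem_sup.1
    (D.map_mem_span_sup_piece (D.completeNoetherIdentities hpos hE hnil j) hℓ)
  obtain ⟨T, hT, hT'⟩ := D.exists_trivial_of_boundary hpos hE hΞ'
  refine ⟨G₀, hG₀, ?_⟩
  have hG₀l : G₀ ∈ linear A V B (j + 1) := by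
    refine Submodule.span_le.2 ?_ hG₀
    rintro _ ⟨Δ, H, hop, -⟩
    exact hop.2.1
  have e' : G - G₀ - T = 0 := by
    refine eq_zero_of_mem_linear_of_mem_piece (Nat.lt_succ_self j)
      (sub_mem (sub_mem hGl hG₀l) hT.1) (e := j + 1) ?_
    have e'' : G - G₀ - T = k + (D.toLin Ξ - T) - Ψ := by
      rw [map_add, ← e₀] at e
      rw [← add_sub_cancel_right G Ψ, ← e]
      abel
    rw [e'']
    exact sub_mem (add_mem hk hT') hΨ
  rwa [sub_eq_zero.1 e']

end Differential

/-! ### Enlarging the family of bundles -/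

/-- A projective module has the lifting property also for maps which are linear over its base ring
through a ring homomorphism. -/
theorem exists_semilinear_lift {R S K M N : Type*} [Ring R] [Ring S] (b : R →+* S)
    [AddCommGroup K] [Module R K] [Module.Projective R K] [AddCommGroup M] [Module S M]
    [AddCommGroup N] [Module S N] (p : M →ₗ[S] N) (hp : Function.Surjective p) (κ : K →ₛₗ[b] N) :
    ∃ Δ : K →ₛₗ[b] M, ∀ c, p (Δ c) = κ c := by
  let _ : Module R M := Module.compHom M b
  let _ : Module R N := Module.compHom N b
  let κ' : K →ₗ[R] N := { toFun := κ, map_add' := map_add κ, map_smul' := κ.map_smulₛₗ }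
  let p' : M →ₗ[R] N :=
    { toFun := p, map_add' := map_add p, map_smul' := fun r x => p.map_smul (b r) x }
  obtain ⟨Δ, hΔ⟩ := Module.projective_lifting_property p' κ' hp
  exact ⟨{ toFun := Δ, map_add' := map_add Δ, map_smul' := Δ.map_smul },
    fun c => LinearMap.congr_fun hΔ c⟩

section Extension

variable {R A : Type u} [CommRing R] [CommRing A] [Algebra ℝ A] [Algebra R A]
  {V : Set (Derivation ℝ A A)} {B : BundleFamily R}
  {n : ℕ} {K : ModuleCat.{u} R} {hf : Module.Finite R K} {hp : Module.Projective R K}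

theorem one_le_ant_extend (hn : 1 ≤ n) (hpos : ∀ i, 1 ≤ B.ant i) (i : (B.extend n K hf hp).ι) :
    1 ≤ (B.extend n K hf hp).ant i :=
  match i with
  | none => hn
  | some i => hpos i

theorem eq_E_of_ant_extend (hn : 2 ≤ n) (hE : ∀ i, B.ant i = 1 → i = B.E)
    (i : (B.extend n K hf hp).ι) (hi : (B.extend n K hf hp).ant i = 1) :
    i = (B.extend n K hf hp).E :=
  match i, hi with
  | none, hi => absurd hi (by change n ≠ 1; omega)
  | some i, hi => congrArg some (hE i hi)

namespace GrRing

theorem incl_fn (a : A) : incl A V B n K hf hp (fn A V B a) = fn A V _ a :=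
  lift_fn _ _ _ _ _ a

theorem incl_jet (i : B.ι) (x : B.Jets A V i) :
    incl A V B n K hf hp (jet A V B i x) = jet A V (B.extend n K hf hp) (some i) x :=
  lift_jet _ _ _ _ _ i x

variable (A V B n K hf hp) in
/-- The inclusion into the ring of the enlarged family as a map of modules over total differential
operators. -/
noncomputable def inclLin : GrRing A V B →ₗ[TotalOp R A V] GrRing A V (B.extend n K hf hp) where
  toFun := incl A V B n K hf hp
  map_add' := map_add _
  map_smul' := map_smul_of_generators _ incl_fn fun i x v => by
    rw [incl_jet, incl_jet]
    exact (totalDer_jet (B := B.extend n K hf hp) v (some i) x).symm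

variable (A V B n K hf hp) in
/-- The retraction of the ring of the enlarged family, which replaces the jets of the additional
bundle by zero. -/
noncomputable def retract : GrRing A V (B.extend n K hf hp) →ₐ[ℝ] GrRing A V B :=
  lift (fn A V B)
    (fun i => match i with
      | none => 0
      | some i => jet A V B i)
    (fun i a x => match i with
      | none => (mul_zero _).symm
      | some i => jet_smul i a x)
    (fun i a x => match i with
      | none => (zero_mul _).trans (mul_zero _).symm
      | some i => jet_mul_fn i a x)
    (fun i j x y => match i, j with
      | none, none => by simp
      | none, some j => by simp
      | some i, none => by simp
      | some i, some j => jet_mul_jet i j x y)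

theorem retract_incl (f : GrRing A V B) :
    retract A V B n K hf hp (incl A V B n K hf hp f) = f := by
  have h : (retract A V B n K hf hp).comp (incl A V B n K hf hp) = AlgHom.id ℝ _ := by
    refine GrRing.hom_ext (fun a => ?_) (fun i x => ?_)
    · rw [AlgHom.comp_apply, incl_fn]
      exact lift_fn _ _ _ _ _ a
    · rw [AlgHom.comp_apply, incl_jet]
      exact lift_jet (B := B.extend n K hf hp) _ _ _ _ _ (some i) x
  exact DFunLike.congr_fun h f

theorem incl_injective : Function.Injective (incl A V B n K hf hp) :=
  Function.LeftInverse.injective retract_incl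

theorem incl_mem_piece {m d : ℕ} {f : GrRing A V B} (h : f ∈ piece A V B m d) :
    incl A V B n K hf hp f ∈ piece A V (B.extend n K hf hp) m d := by
  have key : piece A V B m d ≤
      (piece A V (B.extend n K hf hp) m d).comap (inclLin A V B n K hf hp) := by
    refine Submodule.span_le.2 fun f hf' => Submodule.subset_span ?_
    change IsMonomial A V B m d f at hf'
    change IsMonomial A V _ m d (incl A V B n K hf hp f)
    clear h
    induction hf' with
    | one => rw [map_one]; exact .one
    | mul _ i hi x ih =>
      rw [map_mul, incl_jet]
      exact .mul (B := B.extend n K hf hp) ih (some i) hi x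
  exact key h

theorem exists_incl_of_mem_piece {m d : ℕ} (hm : m < n) {f : GrRing A V (B.extend n K hf hp)}
    (h : f ∈ piece A V (B.extend n K hf hp) m d) :
    ∃ g ∈ piece A V B m d, incl A V B n K hf hp g = f := by
  have key : piece A V (B.extend n K hf hp) m d ≤
      (piece A V B m d).map (inclLin A V B n K hf hp) := by
    refine Submodule.span_le.2 fun f hf' => ?_
    change IsMonomial A V _ m d f at hf'
    clear h
    have h : ∃ g, IsMonomial A V B m d g ∧ incl A V B n K hf hp g = f := by
      induction hf' with
      | one => exact ⟨1, .one, map_one _⟩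
      | mul _ i hi x ih =>
        obtain ⟨g, hg, rfl⟩ := ih
        match i, hi, x with
        | none, hi, x => exact absurd hi (not_le.2 hm)
        | some i, hi, x => exact ⟨g * jet A V B i x, .mul hg i hi x,
          (map_mul _ _ _).trans (congrArg _ (incl_jet i x))⟩
    obtain ⟨g, hg, rfl⟩ := h
    exact ⟨g, Submodule.subset_span hg, rfl⟩
  exact key h

end GrRing

namespace Differential

variable {𝓔 : B.mod B.E →ₗ[R] A} {D : Differential V 𝓔}
  {𝓔' : (B.extend n K hf hp).mod (B.extend n K hf hp).E →ₗ[R] A} {D' : Differential V 𝓔'}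

/-- A differential of the enlarged family extends `D` if it does so on generators. Its operator `𝓔'`
is a variable, because the domain of `𝓔` is a module of the enlarged family only up to unfolding. -/
theorem map_incl_of_jet (h : ∀ i x, D'.toLin (incl A V B n K hf hp (jet A V B i x)) =
      incl A V B n K hf hp (D.toLin (jet A V B i x))) (f : GrRing A V B) :
    D'.toLin (incl A V B n K hf hp f) = incl A V B n K hf hp (D.toLin f) := by
  induction f using GrRing.right_induction with
  | h1 => rw [_root_.map_one, D'.map_one, D.map_one, map_zero]
  | hadd f g ihf ihg => rw [map_add, map_add, map_add, map_add, ihf, ihg]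
  | hc a f ih =>
    have hι : ∀ g, incl A V B n K hf hp (TotalOp.coeff R A V a • g) =
      TotalOp.coeff R A V a • incl A V B n K hf hp g :=
        fun g => (inclLin A V B n K hf hp).map_smul _ g
    rw [hι, map_smul, map_smul, hι, ih]
  | hj f i x ih =>
    have e : D'.toLin (incl A V B n K hf hp f * incl A V B n K hf hp (jet A V B i x)) =
        (-1) ^ B.ant i *
            (D'.toLin (incl A V B n K hf hp f) * incl A V B n K hf hp (jet A V B i x)) +
          incl A V B n K hf hp f * D'.toLin (incl A V B n K hf hp (jet A V B i x)) := by
      rw [incl_jet]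
      exact D'.map_mul_jet _ (some i) x
    rw [map_mul, e, D.map_mul_jet, ih, h, map_add, map_mul, map_mul, map_mul, map_pow, map_neg,
      _root_.map_one]

theorem nilpotent_of_extension (hpos : ∀ i, 1 ≤ (B.extend n K hf hp).ant i) (hnil : D.Nilpotent)
    (h : ∀ f, D'.toLin (incl A V B n K hf hp f) = incl A V B n K hf hp (D.toLin f))
    {Δ : K → GrRing A V B} (hΔ : ∀ c, D.toLin (Δ c) = 0)
    (hK : ∀ c : K, D'.onGen none c = incl A V B n K hf hp (Δ c)) : D'.Nilpotent := by
  refine D'.nilpotent_of_jet hpos fun i x => ?_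
  match i, x with
  | none, x =>
    have hΔ' : ∀ c : K, D'.toLin (incl A V B n K hf hp (Δ c)) = 0 := fun c => by
      rw [h, hΔ, map_zero]
    have h0 : D'.toLin ∘ₗ D'.toLin ∘ₗ jetLin A V (B.extend n K hf hp) none = 0 :=
      JetModule.hom_ext fun c => (congrArg D'.toLin (hK c)).trans (hΔ' c)
    exact LinearMap.congr_fun h0 x
  | some i, x =>
    exact (congrArg (fun z => D'.toLin (D'.toLin z)) (incl_jet i x)).symm.trans
      (by rw [h, h, hnil, map_zero])

theorem regular_of_extension {q : ℕ} (hq : q < n)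
    (h : ∀ f, D'.toLin (incl A V B n K hf hp f) = incl A V B n K hf hp (D.toLin f))
    (hreg : D.Regular q) : D'.Regular q := by
  intro m hm hmq Φ hΦ hcyc
  obtain ⟨Φ, hΦ', rfl⟩ := exists_incl_of_mem_piece (hmq.trans hq) hΦ
  rw [h] at hcyc
  obtain ⟨Ψ, hΨ, e⟩ := hreg m hm hmq Φ hΦ' (incl_injective (hcyc.trans (map_zero _).symm))
  exact ⟨_, incl_mem_piece hΨ, by rw [h, e]⟩

end Differential

end Extension

section Extension

variable {R A : Type u} [CommRing R] [CommRing A] [Algebra ℝ A] [Algebra R A]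
  {V : Set (Derivation ℝ A A)} {B : BundleFamily R}
  {q : ℕ} {K : ModuleCat.{u} R} {hf : Module.Finite R K} {hp : Module.Projective R K}
  {𝓔 : B.mod B.E →ₗ[R] A} {D : Differential V 𝓔}

namespace Differential

theorem incl_mem_boundaries {n d : ℕ}
    {𝓔' : (B.extend n K hf hp).mod (B.extend n K hf hp).E →ₗ[R] A} {D' : Differential V 𝓔'}
    (h : ∀ f, D'.toLin (incl A V B n K hf hp f) = incl A V B n K hf hp (D.toLin f))
    {f : GrRing A V B} (hb : f ∈ D.boundaries d) :
    incl A V B n K hf hp f ∈ D'.boundaries d := by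
  obtain ⟨g, hg, rfl⟩ := hb
  exact ⟨_, incl_mem_piece hg, h g⟩

/-- The additional generators kill the homology in which the complex was not exact. -/
theorem exact_of_extension
    {𝓔' : (B.extend (q + 2) K hf hp).mod (B.extend (q + 2) K hf hp).E →ₗ[R] A}
    {D' : Differential V 𝓔'} (hexact : D.Exact q)
    (h : ∀ f, D'.toLin (incl A V B (q + 2) K hf hp f) = incl A V B (q + 2) K hf hp (D.toLin f))
    {κ : D.HomologyMap (q + 1) K} (hκ : D.IsGeneratedThrough κ) {Δ : D.CycleMap (q + 1) K}
    (hΔ : D.Represents Δ κ)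
    (hK : ∀ c : K, D'.onGen none c = incl A V B (q + 2) K hf hp (Δ c)) : D'.Exact (q + 1) := by
  rintro d hd hdq f ⟨hcyc, hfd⟩
  obtain ⟨f, hfd', rfl⟩ := exists_incl_of_mem_piece (by omega) hfd
  replace hcyc : D'.toLin (incl A V B (q + 2) K hf hp f) = 0 := hcyc
  rw [h] at hcyc
  have hcyc' : D.toLin f = 0 := incl_injective (hcyc.trans (map_zero _).symm)
  rcases Nat.eq_or_lt_of_le hdq with rfl | hlt
  · -- The cycle is homologous to a combination of the cycles `Δ c`, the boundaries of
    -- the new generators.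
    have hspan : Submodule.map (D.cls (q + 1)) (Submodule.span _ (Set.range Δ)) = ⊤ := by
      rw [← hκ.2, Submodule.map_span, ← Set.range_comp]
      exact congrArg _ (congrArg _ (funext hΔ))
    have hmem : D.cls (q + 1) ⟨f, hcyc', hfd'⟩ ∈
      Submodule.map (D.cls (q + 1)) (Submodule.span _ (Set.range Δ)) := hspan ▸ Submodule.mem_top
    obtain ⟨z, hz, hzf⟩ := hmem
    have hzb : Submodule.span (TotalOp R A V) (Set.range Δ) ≤
        ((D'.boundaries (q + 1)).comap (inclLin A V B (q + 2) K hf hp)).comap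
          (D.cycles (q + 1)).subtype := by
      refine Submodule.span_le.2 ?_
      rintro _ ⟨c, rfl⟩
      exact ⟨_, jet_mem_chains (B := B.extend (q + 2) K hf hp) none _, hK c⟩
    have hsub : z - ⟨f, hcyc', hfd'⟩ ∈ (D.boundaries (q + 1)).submoduleOf (D.cycles (q + 1)) :=
      (Submodule.Quotient.eq _).1 hzf
    have h1 : incl A V B (q + 2) K hf hp z ∈ D'.boundaries (q + 1) := hzb hz
    have h2 : incl A V B (q + 2) K hf hp (z - f) ∈ D'.boundaries (q + 1) :=
      incl_mem_boundaries h hsub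
    rw [← sub_sub_cancel (z : GrRing A V B) f, map_sub]
    exact sub_mem h1 h2
  · exact incl_mem_boundaries h (hexact d hd (by omega) ⟨hcyc', hfd'⟩)

/-- Extending a differential by assigning cycles to the generators of an additional bundle. -/
theorem exists_isExtension {n : ℕ} (hpos : ∀ i, 1 ≤ B.ant i) (hf : Module.Finite R K)
    (hp : Module.Projective R K) (Δ : D.CycleMap n K) :
    ∃ D' : Differential (B := B.extend (n + 1) K hf hp) V 𝓔, D.IsExtension D' (fun c => Δ c) := by
  let ι := inclLin A V B (n + 1) K hf hp
  let σ : K →ₛₗ[TotalOp.base R A V] GrRing A V (B.extend (n + 1) K hf hp) :=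
    (ι ∘ₗ (D.cycles n).subtype).comp Δ
  let s : ∀ i, (B.extend (n + 1) K hf hp).Jets A V i →ₗ[TotalOp R A V]
      GrRing A V (B.extend (n + 1) K hf hp) := fun i => match i with
    | none => JetModule.lift σ
    | some i => ι ∘ₗ D.toLin ∘ₗ jetLin A V B i
  have hpos' := one_le_ant_extend (hf := hf) (hp := hp) (Nat.succ_pos n) hpos
  have hs : ∀ i x, s i x ∈ chains A V (B.extend (n + 1) K hf hp)
      ((B.extend (n + 1) K hf hp).ant i - 1) := fun i x => match i with
    | none => by
      have h : (⊤ : Submodule (TotalOp R A V) (JetModule R A V K)) ≤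
          (chains A V (B.extend (n + 1) K hf hp) n).comap (JetModule.lift σ) := by
        rw [← JetModule.span_range_of, Submodule.span_le]
        rintro _ ⟨c, rfl⟩
        change JetModule.lift σ _ ∈ chains A V _ n
        rw [JetModule.lift_of]
        exact incl_mem_piece (Δ c).2.2
      exact h (Submodule.mem_top (x := x))
    | some i => incl_mem_piece (D.map_jet_mem_chains hpos i x)
  -- The operator, with its domain written as a module of the enlarged family.
  let 𝓔' : (B.extend (n + 1) K hf hp).mod (B.extend (n + 1) K hf hp).E →ₗ[R] A := 𝓔
  have hE : ∀ c, s (B.extend (n + 1) K hf hp).E (JetModule.of R A V _ c) = fn A V _ (𝓔' c) :=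
    fun c => (congrArg (incl A V B (n + 1) K hf hp) (D.map_E' c)).trans (incl_fn _)
  exact ⟨ofGenerators hpos' s hs hE,
    map_incl_of_jet (fun i x => (congrArg (ofGenerators hpos' s hs hE).toLin (incl_jet i x)).trans
      (ofGenerators_jet hpos' s hs hE (some i) x)),
    fun c => (ofGenerators_jet hpos' s hs hE none _).trans (JetModule.lift_of σ c)⟩

end Differential

end Extension

end KoszulTate

theorem theorem1 {EX EY EF : Type*}
    [NormedAddCommGroup EX] [NormedSpace ℝ EX] [FiniteDimensional ℝ EX]
    [NormedAddCommGroup EY] [NormedSpace ℝ EY] [FiniteDimensional ℝ EY]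
    [NormedAddCommGroup EF] [NormedSpace ℝ EF] [FiniteDimensional ℝ EF]
    {X Y : Type u} {F : Type*}
    [TopologicalSpace X] [ChartedSpace EX X] [IsManifold 𝓘(ℝ, EX) ∞ X]
    [T2Space X] [SecondCountableTopology X]
    [TopologicalSpace Y] [ChartedSpace EY Y] [IsManifold 𝓘(ℝ, EY) ∞ Y]
    [T2Space Y] [SecondCountableTopology Y]
    [TopologicalSpace F] [ChartedSpace EF F] [IsManifold 𝓘(ℝ, EF) ∞ F]
    (π : Y → X) (_hπ : IsSmoothFiberBundle EX EY EF F π)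
    (B : BundleFamily (BaseFunctions EX X)) (N : ℕ)
    (_hB : Set.BijOn B.ant Set.univ (Set.Icc 1 (N + 2)))
    (𝓔 : B.mod B.E →ₗ[BaseFunctions EX X] JetFunctions EX EY π)
    (D : Differential (totalDerivatives EX EY π) 𝓔)
    (_hnil : D.Nilpotent) (_hexact : D.Exact (N + 1)) (_hreg : D.Regular (N + 1)) :
    (D.NoetherIdentified (N + 1) ↔ D.Regular (N + 2)) ∧
    ∀ (K : ModuleCat.{u} (BaseFunctions EX X))
      (hf : Module.Finite (BaseFunctions EX X) K)
      (hp : Module.Projective (BaseFunctions EX X) K)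
      (κ : D.HomologyMap (N + 2) K), D.IsGeneratedThrough κ →
      (∃ Δ : D.CycleMap (N + 2) K, D.Represents Δ κ) ∧
      (∀ Δ : D.CycleMap (N + 2) K, D.Represents Δ κ →
        ∃ D' : Differential (B := B.extend (N + 3) K hf hp) (totalDerivatives EX EY π) 𝓔,
          D.IsExtension D' (fun c => Δ c) ∧ D'.Nilpotent ∧ D'.Exact (N + 2) ∧
          D'.CompleteNoetherIdentities (N + 1) ∧ D'.NoetherIdentitiesGenerated (N + 1)) ∧
      ∀ D' : Differential (B := B.extend (N + 3) K hf hp) (totalDerivatives EX EY π) 𝓔,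
        D'.Nilpotent → D'.CompleteNoetherIdentities (N + 1) := by
  have hpos : ∀ i, 1 ≤ B.ant i := fun i => (_hB.mapsTo (Set.mem_univ i)).1
  have htop : ∀ i, B.ant i ≤ N + 2 := fun i => (_hB.mapsTo (Set.mem_univ i)).2
  have hE : ∀ i, B.ant i = 1 → i = B.E := fun i hi =>
    _hB.injOn (Set.mem_univ i) (Set.mem_univ _) (hi.trans B.ant_E.symm)
  refine ⟨D.noetherIdentified_iff_regular hpos hE htop (Nat.succ_pos N) _hnil _hreg, ?_⟩
  intro K hf hp κ hκ
  have hpos' := one_le_ant_extend (hf := hf) (hp := hp) (show 1 ≤ N + 3 by omega) hpos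
  have hE' := eq_E_of_ant_extend (hf := hf) (hp := hp) (show 2 ≤ N + 3 by omega) hE
  refine ⟨exists_semilinear_lift _ (D.cls (N + 2)) (Submodule.mkQ_surjective _) κ,
    fun Δ hΔ => ?_, fun D' hnil => D'.completeNoetherIdentities hpos' hE' hnil (N + 1)⟩
  obtain ⟨D', hext⟩ := Differential.exists_isExtension hpos hf hp Δ
  have hnil := Differential.nilpotent_of_extension hpos' _hnil hext.1 (fun c => (Δ c).2.1) hext.2
  have hexact := Differential.exact_of_extension _hexact hext.1 hκ hΔ hext.2
  have hreg := Differential.regular_of_extension (show N + 1 < N + 3 by omega) hext.1 _hreg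
  exact ⟨D', hext, hnil, hexact, D'.completeNoetherIdentities hpos' hE' hnil (N + 1),
    D'.noetherIdentitiesGenerated_of_exact hpos' hE' hnil hexact hreg⟩
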